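/- Let $\lambda>0$ and $\frac{2\lambda}{2\lambda+1}<p\le 1$. For $x_0\in\mathbb R$ and $\delta_0>0$ put $I(x_0,\delta_0)=\{x\in\mathbb R:|x-x_0|<\delta_0\}$ and $|I(x_0,\delta_0)|_\lambda=\int_{I(x_0,\delta_0)}|x|^{2\lambda}\,dx$. For a constant $A>0$, a Lebesgue measurable function $a:\mathbb R\to\mathbb C$ is called a $p_\lambda$-atom with size constant $A$ and vanishing moments up to order $\kappa\in\mathbb N$ if $\kappa\ge 2\left[(2\lambda+1)\frac{1-p}{p}\right]$ (where $[\cdot]$ is the integer part), $\int_{\mathbb R}t^k a(t)|t|^{2\lambda}\,dt=0$ for $k=0,1,\dots,\kappa$, and there are $x_0\in\mathbb R$ and $0<\delta_0<|x_0|/2$ such that $a$ vanishes almost everywhere outside $I(x_0,\delta_0)$ and $\|a\|_{L^\infty}\le A\,|I(x_0,\delta_0)|_\lambda^{-1/p}$. The $\lambda$-Hilbert transform of such a function is $$\mathcal H_\lambda a(x)=c_\lambda\lim_{\epsilon\to0+}\int_{|t-x|>\epsilon}a(t)\,h(x,t)\,|t|^{2\lambda}\,dt,\qquad c_\lambda^{-1}=2^{\lambda+1/2}\,\Gamma(\lambda+\tfrac12),$$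 $$h(x,t)=\frac{\lambda\,\Gamma(\lambda+1/2)}{2^{-\lambda-1/2}\,\pi}\,(x-t)\int_{-1}^1\frac{(1+s)(1-s^2)^{\lambda-1}}{(x^2+t^2-2xts)^{\lambda+1}}\,ds .$$ Then there is a constant $C>0$, depending only on $\lambda$ and $p$, such that for every $A>0$, every $\kappa$ and every $p_\lambda$-atom $a$ with size constant $A$ and vanishing moments up to order $\kappa$, the limit defining $\mathcal H_\lambda a(x)$ exists for almost every $x\in\mathbb R$, and $$\int_{\mathbb R}|\mathcal H_\lambda a(x)|^p\,|x|^{2\lambda}\,dx\le C\,A^p .$$ -/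

import Mathlib

open MeasureTheory Filter Topology

noncomputable section

namespace Dunkl

/-- The normalising constant `c_λ`, with `c_λ⁻¹ = 2^(λ+1/2) Γ(λ+1/2)`. -/
def c (lam : ℝ) : ℝ := ((2 : ℝ) ^ (lam + 1 / 2) * Real.Gamma (lam + 1 / 2))⁻¹

/-- The weighted length `|I(x₀,δ₀)|_λ = ∫ |x|^(2λ) dx` over the interval `|x - x₀| < δ₀`. -/
def weightedLength (lam x₀ δ₀ : ℝ) : ℝ :=
  ∫ x in Set.Ioo (x₀ - δ₀) (x₀ + δ₀), |x| ^ (2 * lam)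

/-- The `λ`-Hilbert kernel `h(x,t)`. -/
def hilbertKernel (lam x t : ℝ) : ℝ :=
  lam * Real.Gamma (lam + 1 / 2) / ((2 : ℝ) ^ (-lam - 1 / 2) * Real.pi) * (x - t) *
    ∫ s in (-1 : ℝ)..1,
      (1 + s) * (1 - s ^ 2) ^ (lam - 1) / (x ^ 2 + t ^ 2 - 2 * x * t * s) ^ (lam + 1)

/-- The truncated integrals `c_λ ∫_{|t-x|>ε} f(t) h(x,t) |t|^(2λ) dt`. -/
def truncatedHilbert (lam : ℝ) (f : ℝ → ℂ) (x ε : ℝ) : ℂ :=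
  (c lam : ℂ) * ∫ t in {t : ℝ | ε < |t - x|},
    f t * (hilbertKernel lam x t : ℂ) * ((|t| ^ (2 * lam) : ℝ) : ℂ)

/-- The `λ`-Hilbert transform: the limit of the truncated integrals as `ε → 0+`. -/
def hilbertTransform (lam : ℝ) (f : ℝ → ℂ) (x : ℝ) : ℂ :=
  limUnder (𝓝[>] (0 : ℝ)) (truncatedHilbert lam f x)

/-- `a` is a `p_λ`-atom with size constant `A` (the constant implicit in the size condition)
and vanishing moments up to order `κ`. Square brackets denote the integer part. -/
structure IsAtom (lam p A : ℝ) (κ : ℕ) (a : ℝ → ℂ) : Prop where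
  /-- `a` is Lebesgue measurable. -/
  measurable : AEStronglyMeasurable a volume
  /-- The size and support conditions, for some interval `I(x₀,δ₀)` with `δ₀ < |x₀|/2`. -/
  size_support : ∃ x₀ δ₀ : ℝ, 0 < δ₀ ∧ δ₀ < |x₀| / 2 ∧
    eLpNorm a ⊤ volume ≤ ENNReal.ofReal (A / weightedLength lam x₀ δ₀ ^ (1 / p)) ∧
    ∀ᵐ t : ℝ, t ∉ Set.Ioo (x₀ - δ₀) (x₀ + δ₀) → a t = 0
  /-- `κ ≥ 2[(2λ+1)(1-p)/p]`. -/
  order : 2 * ⌊(2 * lam + 1) * ((1 - p) / p)⌋ ≤ (κ : ℤ)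
  /-- The moments of orders `0, …, κ` vanish. -/
  moments : ∀ k : ℕ, k ≤ κ →
    ∫ t : ℝ, (t : ℂ) ^ k * a t * ((|t| ^ (2 * lam) : ℝ) : ℂ) = 0

end Dunkl

end

namespace Dunkl

/-! The kernel times |t|^(2λ) dt is homogeneous of degree zero, so dilation by x₀ changes the
transform only by the sign of x₀ (`truncatedHilbert_dilate`). It suffices to take b with |b| ≤ 1
supported in |t - 1| < δ, δ = δ₀/|x₀| < 1/2, and to show ∫ |H b|^p |x|^(2λ) ≤ C δ
(`exists_core_bound`); the lower bound |I|_λ ≥ 2 δ₀ (|x₀|/2)^(2λ) turns this into C A^p.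

Where ||x| - 1| ≤ 8δ (`exists_near_bound`), for x > 0 the weighted kernel is a multiple of 1/(x - t)
plus a bounded error, and for x ≤ 0 it has only a singularity of order ||x| - t|^(-1/2). Hence |H b|
≤ C (1 + |g|) with g the classical Hilbert transform of b, and ∫ |g|² = O(δ). The set itself has
measure O(δ), and p-th powers are dominated by 1 + |g|².

Where D = ||x| - 1| > 8δ (`exists_far_bound`), each s-slice of the kernel extends holomorphically in
t to the disc of radius D/4 about 1. Vanishing moments of orders below k remove its Taylor
polynomial, so |H b| ≤ C (δ/D)^(k+1) (1 + |x|)^(-2λ). The p-th power integrates against |x|^(2λ) to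
O(δ) as soon as (k+1) p > 1 + 2λ(1-p), which k = [(2λ+1)(1-p)/p] + 1 satisfies.

The classical input is `exists_classical_limit`. Conjugate Poisson transforms have the same L² norms
as Poisson transforms, hence are bounded in L² uniformly in y. Letting y → 0, the logarithmic
potential has locally bounded variation and is differentiable a.e. Its symmetric difference
quotients, the conjugate Poisson transforms and the truncated Hilbert transforms differ from one
another by convolutions with dilates of odd integrable kernels, and these vanish in the limit at
Lebesgue points. So all three converge a.e. to the same derivative, and Fatou's lemma carries the L²
bound to the limit. -/

/-! ### Approximate identities at Lebesgue points -/

theorem integral_indicator_rescale (F : ℝ → ℝ) (x N : ℝ) {ε : ℝ} (hε : 0 < ε) :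
    ∫ u in Set.Icc (-N) N, F (x - ε * u) = ε⁻¹ * ∫ t in Metric.closedBall x (ε * N), F t := by
  rw [← integral_indicator measurableSet_Icc, ← integral_indicator measurableSet_closedBall]
  have h1 := Measure.integral_comp_mul_left
    (fun v => (Metric.closedBall x (ε * N)).indicator F (x - v)) ε
  rw [integral_sub_left_eq_self (fun v => (Metric.closedBall x (ε * N)).indicator F v) volume x,
    abs_of_pos (inv_pos.2 hε), smul_eq_mul] at h1
  rw [← h1]
  congr 1
  ext u
  have : u ∈ Set.Icc (-N) N ↔ x - ε * u ∈ Metric.closedBall x (ε * N) := by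
    rw [Metric.mem_closedBall, Real.dist_eq, Set.mem_Icc, ← abs_le]
    rw [show x - ε * u - x = -(ε * u) by ring, abs_neg, abs_mul, abs_of_pos hε]
    exact (mul_le_mul_iff_right₀ hε).symm
  by_cases h : u ∈ Set.Icc (-N) N
  · rw [Set.indicator_of_mem h, Set.indicator_of_mem (this.1 h)]
  · rw [Set.indicator_of_notMem h, Set.indicator_of_notMem (fun h' => h (this.2 h'))]

/-- Undoing the scaling gives 2N times the mean of |f - f x| over the ball of radius εN, so this is
Lebesgue's differentiation theorem. The exceptional set does not depend on N. -/
theorem ae_tendsto_integral_rescale {f : ℝ → ℝ} (hf : Measurable f) (hb : ∀ t, |f t| ≤ 1) :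
    ∀ᵐ x : ℝ, ∀ N : ℝ, 0 < N → Tendsto
      (fun ε : ℝ => ∫ u in Set.Icc (-N) N, |f (x - ε * u) - f x|) (𝓝[>] 0) (𝓝 0) := by
  have hloc : LocallyIntegrable f volume := by
    intro x
    refine ⟨Metric.ball x 1, Metric.ball_mem_nhds x one_pos, ?_⟩
    refine Measure.integrableOn_of_bounded (M := 1) ?_ hf.aestronglyMeasurable ?_
    · exact measure_ball_lt_top.ne
    · exact ae_of_all _ hb
  filter_upwards [IsUnifLocDoublingMeasure.ae_tendsto_average_norm_sub volume hloc 1] with x hx N hN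
  have hδ : Tendsto (fun ε : ℝ => ε * N) (𝓝[>] 0) (𝓝[>] 0) := by
    refine tendsto_nhdsWithin_iff.2 ⟨?_, ?_⟩
    · have : Tendsto (fun ε : ℝ => ε * N) (𝓝 0) (𝓝 (0 * N)) := tendsto_id.mul_const N
      rw [zero_mul] at this
      exact this.mono_left nhdsWithin_le_nhds
    · filter_upwards [self_mem_nhdsWithin] with ε hε using mul_pos hε hN
  have h1 := hx (fun _ : ℝ => x) (fun ε : ℝ => ε * N) hδ (by
    filter_upwards [self_mem_nhdsWithin] with ε hε
    rw [Metric.mem_closedBall, dist_self]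
    have : (0 : ℝ) < ε := hε
    positivity)
  have h2 := h1.const_mul (2 * N)
  rw [mul_zero] at h2
  refine h2.congr' ?_
  filter_upwards [self_mem_nhdsWithin] with ε hε
  have hε : (0 : ℝ) < ε := hε
  rw [integral_indicator_rescale (fun t => |f t - f x|) x N hε, setAverage_eq, Measure.real,
    Real.volume_closedBall, ENNReal.toReal_ofReal (by positivity), smul_eq_mul]
  simp only [Real.norm_eq_abs]
  field_simp

/-- Cutting off both the argument and the value leaves a part of ψ that is bounded by N and
supported in [-N, N]. That part needs only convergence of means of f; the discarded mass is small by
dominated convergence. -/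
theorem tendsto_integral_tail {ψ : ℝ → ℝ} (hψ : Integrable ψ) (hm : Measurable ψ) :
    Tendsto (fun N : ℕ => ∫ u, {u : ℝ | |u| ≤ N ∧ |ψ u| ≤ N}ᶜ.indicator (fun u => |ψ u|) u)
      atTop (𝓝 0) := by
  have hS : ∀ N : ℕ, MeasurableSet {u : ℝ | |u| ≤ N ∧ |ψ u| ≤ N} := fun N =>
    (measurableSet_le measurable_id.abs measurable_const).inter
      (measurableSet_le hm.abs measurable_const)
  have := tendsto_integral_of_dominated_convergence (μ := volume)
    (F := fun (N : ℕ) u => {u : ℝ | |u| ≤ N ∧ |ψ u| ≤ N}ᶜ.indicator (fun u => |ψ u|) u)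
    (f := fun _ => 0) (fun u => |ψ u|)
    (fun N => (hm.abs.indicator (hS N).compl).aestronglyMeasurable) hψ.abs
    (fun N => ae_of_all _ fun u => by
      by_cases h : u ∈ {u : ℝ | |u| ≤ N ∧ |ψ u| ≤ N}ᶜ
      · rw [Set.indicator_of_mem h]; simp
      · rw [Set.indicator_of_notMem h]; simp)
    (ae_of_all _ fun u => by
      refine tendsto_const_nhds.congr' ?_
      filter_upwards [eventually_ge_atTop (⌈|u|⌉₊ + ⌈|ψ u|⌉₊)] with N hN
      rw [Set.indicator_of_notMem]
      rw [Set.mem_compl_iff, not_not]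
      have h1 := Nat.le_ceil |u|
      have h2 := Nat.le_ceil |ψ u|
      have h3 : ((⌈|u|⌉₊ + ⌈|ψ u|⌉₊ : ℕ) : ℝ) ≤ N := by exact_mod_cast hN
      push_cast at h3
      constructor
      · have : (0:ℝ) ≤ ⌈|ψ u|⌉₊ := by positivity
        linarith
      · have : (0:ℝ) ≤ ⌈|u|⌉₊ := by positivity
        linarith)
  simpa using this

/-- Rescaled integrable kernels form an approximate identity at the Lebesgue points of a bounded
function; no monotone majorant of the kernel is needed. -/
theorem ae_tendsto_integral_approx {f : ℝ → ℝ} (hf : Measurable f) (hb : ∀ t, |f t| ≤ 1) :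
    ∀ᵐ x : ℝ, ∀ ψ : ℝ → ℝ, Measurable ψ → Integrable ψ →
      Tendsto (fun ε : ℝ => ∫ u, f (x - ε * u) * ψ u) (𝓝[>] 0) (𝓝 (f x * ∫ u, ψ u)) := by
  filter_upwards [ae_tendsto_integral_rescale hf hb] with x hx ψ hm hψ
  rw [Metric.tendsto_nhds]
  intro η hη
  have hfm : ∀ ε : ℝ, Measurable fun u => f (x - ε * u) := fun ε => by fun_prop
  have hd : ∀ ε u : ℝ, |f (x - ε * u) - f x| ≤ 2 := fun ε u => by
    refine (abs_sub _ _).trans ?_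
    linarith [hb (x - ε * u), hb x]
  -- On the tail |f(x - εu) - f x| ≤ 2, costing less than 2 · η/4; on the truncated part |ψ| ≤ N,
  -- costing less than N · η/(2N). Together this is below η.
  obtain ⟨N, hN, hN0⟩ := (((tendsto_integral_tail hψ hm).eventually
    (gt_mem_nhds (show (0:ℝ) < η / 4 by positivity))).and (eventually_gt_atTop 0)).exists
  have hN0' : (0 : ℝ) < N := by exact_mod_cast hN0
  set S : Set ℝ := {u : ℝ | |u| ≤ N ∧ |ψ u| ≤ N} with hSdef
  have hS : MeasurableSet S :=
    (measurableSet_le measurable_id.abs measurable_const).inter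
      (measurableSet_le hm.abs measurable_const)
  filter_upwards [(hx N hN0').eventually (gt_mem_nhds (show (0:ℝ) < η / (2 * N) by positivity))]
    with ε hε
  rw [Real.dist_eq, ← integral_const_mul, ← integral_sub]
  rotate_left
  · exact hψ.bdd_mul (hfm ε).aestronglyMeasurable (ae_of_all _ fun u => hb _)
  · exact hψ.const_mul _
  have i1 : Integrable (fun u => (Set.Icc (-(N:ℝ)) N).indicator
      (fun u => |f (x - ε * u) - f x|) u) := by
    rw [integrable_indicator_iff measurableSet_Icc]
    refine Measure.integrableOn_of_bounded (M := 2) (by simp)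
      ((hfm ε).sub_const _).abs.aestronglyMeasurable (ae_of_all _ fun u => ?_)
    simpa using hd ε u
  have i2 : Integrable (fun u => Sᶜ.indicator (fun u => |ψ u|) u) := hψ.abs.indicator hS.compl
  calc |∫ u, (f (x - ε * u) * ψ u - f x * ψ u)|
      ≤ ∫ u, |f (x - ε * u) * ψ u - f x * ψ u| := abs_integral_le_integral_abs
    _ ≤ ∫ u, (N * (Set.Icc (-(N:ℝ)) N).indicator (fun u => |f (x - ε * u) - f x|) u
          + 2 * Sᶜ.indicator (fun u => |ψ u|) u) := by
        refine integral_mono_of_nonneg (ae_of_all _ fun u => abs_nonneg _)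
          ((i1.const_mul _).add (i2.const_mul _)) (ae_of_all _ fun u => ?_)
        simp only
        rw [← sub_mul, abs_mul]
        by_cases h : u ∈ S
        · have h1 : u ∈ Set.Icc (-(N:ℝ)) N := abs_le.1 h.1
          rw [Set.indicator_of_mem h1, Set.indicator_of_notMem (by simpa using h), mul_zero,
            add_zero, mul_comm]
          exact mul_le_mul_of_nonneg_right h.2 (abs_nonneg _)
        · rw [Set.indicator_of_mem (show u ∈ Sᶜ from h)]
          have : 0 ≤ (Set.Icc (-(N:ℝ)) N).indicator (fun u => |f (x - ε * u) - f x|) u :=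
            Set.indicator_nonneg (fun u _ => abs_nonneg _) u
          have h2 := mul_le_mul_of_nonneg_right (hd ε u) (abs_nonneg (ψ u))
          nlinarith
    _ = N * (∫ u in Set.Icc (-(N:ℝ)) N, |f (x - ε * u) - f x|)
          + 2 * ∫ u, Sᶜ.indicator (fun u => |ψ u|) u := by
        rw [integral_add (i1.const_mul _) (i2.const_mul _), integral_const_mul,
          integral_const_mul, integral_indicator measurableSet_Icc]
    _ < η := by
        have h1 : N * (∫ u in Set.Icc (-(N:ℝ)) N, |f (x - ε * u) - f x|) < N * (η / (2 * N)) :=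
          mul_lt_mul_of_pos_left hε hN0'
        have h2 : (N : ℝ) * (η / (2 * N)) = η / 2 := by field_simp
        linarith

/-! ### The Poisson kernel and the cross kernel -/

theorem integrable_inv_sq_add_sq {y : ℝ} (hy : 0 < y) :
    Integrable fun u : ℝ => (u ^ 2 + y ^ 2)⁻¹ := by
  have := (integrable_inv_one_add_sq.comp_div hy.ne').const_mul ((y ^ 2)⁻¹)
  refine this.congr (ae_of_all _ fun u => ?_)
  simp only
  rw [← mul_inv]
  congr 1
  field_simp
  ring

theorem integral_poisson {y : ℝ} (hy : 0 < y) : ∫ u : ℝ, y / (u ^ 2 + y ^ 2) = Real.pi := by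
  have h := Measure.integral_comp_div (fun u : ℝ => (1 + u ^ 2)⁻¹) y
  rw [integral_univ_inv_one_add_sq, abs_of_pos hy, smul_eq_mul] at h
  have : (fun u : ℝ => y / (u ^ 2 + y ^ 2)) = fun u => y⁻¹ * (1 + (u / y) ^ 2)⁻¹ := by
    ext u
    field_simp
    ring
  rw [this, integral_const_mul, h]
  field_simp

/-- This gives the boundary values of the primitive of the cross kernel; the general filter covers
both +∞ and -∞. -/
theorem integral_cross_kernel_aux (y t s : ℝ) {l : Filter ℝ} (hl : Tendsto (fun x : ℝ => x⁻¹) l (𝓝 0))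
    (hl0 : ∀ᶠ x in l, x ≠ 0) :
    Tendsto (fun x : ℝ => Real.log (((x - t) ^ 2 + y ^ 2) / ((x - s) ^ 2 + y ^ 2))) l (𝓝 0) := by
  have hA : ∀ t : ℝ, Tendsto (fun x : ℝ => (1 - t * x⁻¹) ^ 2 + (y * x⁻¹) ^ 2) l (𝓝 1) := fun t => by
    have := ((tendsto_const_nhds (x := (1 : ℝ))).sub (hl.const_mul t)).pow 2 |>.add
      ((hl.const_mul y).pow 2)
    simpa using this
  have h1 := (hA t).div (hA s) one_ne_zero
  rw [div_one] at h1
  have h2 := (Real.continuousAt_log one_ne_zero).tendsto.comp h1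
  rw [Real.log_one] at h2
  refine h2.congr' ?_
  filter_upwards [hl0] with x hx
  simp only [Function.comp, Pi.div_apply]
  congr 1
  have e : ∀ t : ℝ, (1 - t * x⁻¹) ^ 2 + (y * x⁻¹) ^ 2 = ((x - t) ^ 2 + y ^ 2) / x ^ 2 := fun t => by
    field_simp
  rw [e, e, div_div_div_cancel_right₀ (pow_ne_zero 2 hx)]

/-- From |uv - y²| ≤ u² + v² + 2y². The majorant separates the two variables, which makes the triple
integral below absolutely convergent. -/
theorem abs_cross_kernel_le {y : ℝ} (hy : 0 < y) (u v : ℝ) :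
    |(u * v - y ^ 2) / ((u ^ 2 + y ^ 2) * (v ^ 2 + y ^ 2))|
      ≤ (u ^ 2 + y ^ 2)⁻¹ + (v ^ 2 + y ^ 2)⁻¹ := by
  have hu : 0 < u ^ 2 + y ^ 2 := by positivity
  have hv : 0 < v ^ 2 + y ^ 2 := by positivity
  rw [abs_div, abs_of_pos (mul_pos hu hv), inv_eq_one_div, inv_eq_one_div,
    div_add_div _ _ hu.ne' hv.ne']
  refine div_le_div_of_nonneg_right ?_ (mul_pos hu hv).le
  rw [abs_le]
  constructor <;> nlinarith [sq_nonneg (u + v), sq_nonneg (u - v), sq_nonneg y]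

/-- The integrand is the real part of 1/((x - t + iy)(x - s + iy)), analytic in the upper half-plane
with quadratic decay. On the real line this shows as a primitive, the log-ratio divided by 2(t - s),
that vanishes at both infinities. -/
theorem integral_cross_kernel {y : ℝ} (hy : 0 < y) {t s : ℝ} (hts : t ≠ s) :
    ∫ x : ℝ, ((x - t) * (x - s) - y ^ 2) /
      (((x - t) ^ 2 + y ^ 2) * ((x - s) ^ 2 + y ^ 2)) = 0 := by
  have hd : ∀ x : ℝ, HasDerivAt (fun x : ℝ => (2 * (t - s))⁻¹ *
      Real.log (((x - t) ^ 2 + y ^ 2) / ((x - s) ^ 2 + y ^ 2)))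
      (((x - t) * (x - s) - y ^ 2) / (((x - t) ^ 2 + y ^ 2) * ((x - s) ^ 2 + y ^ 2))) x := by
    intro x
    have hA : ∀ t : ℝ, HasDerivAt (fun x : ℝ => (x - t) ^ 2 + y ^ 2) (2 * (x - t)) x := fun t => by
      have := (((hasDerivAt_id x).sub_const t).pow 2).add_const (y ^ 2)
      simpa using this
    have p : ∀ t : ℝ, 0 < (x - t) ^ 2 + y ^ 2 := fun t => by positivity
    have h := (((hA t).div (hA s) (p s).ne').log (div_pos (p t) (p s)).ne').const_mul
      ((2 * (t - s))⁻¹)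
    refine h.congr_deriv ?_
    have h1 := (p t).ne'
    have h2 := (p s).ne'
    have h3 : t - s ≠ 0 := sub_ne_zero.2 hts
    simp only [Pi.div_apply]
    field_simp
    ring
  have hint : Integrable fun x : ℝ => ((x - t) * (x - s) - y ^ 2) /
      (((x - t) ^ 2 + y ^ 2) * ((x - s) ^ 2 + y ^ 2)) := by
    refine (((integrable_inv_sq_add_sq hy).comp_sub_right t).add
      ((integrable_inv_sq_add_sq hy).comp_sub_right s)).mono' ?_ (ae_of_all _ fun x => ?_)
    · exact (by fun_prop : Measurable _).aestronglyMeasurable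
    · exact abs_cross_kernel_le hy _ _
  have := integral_of_hasDerivAt_of_tendsto hd hint
    ((integral_cross_kernel_aux y t s tendsto_inv_atBot_zero (eventually_ne_atBot 0)).const_mul _)
    ((integral_cross_kernel_aux y t s tendsto_inv_atTop_zero (eventually_ne_atTop 0)).const_mul _)
  simpa using this

/-- By translation invariance the inner integral of |k| does not depend on the shift c a. The
general space α allows both α = ℝ and pairs (t, s) shifted by either coordinate. -/
theorem integrable_mul_translate {α : Type*} [MeasurableSpace α] {μ : Measure α} [SFinite μ]
    {g c : α → ℝ} {k : ℝ → ℝ} (hg : Integrable g μ) (hgm : Measurable g) (hc : Measurable c)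
    (hk : Integrable k) (hkm : Measurable k) :
    Integrable (fun z : ℝ × α => g z.2 * k (z.1 - c z.2)) (volume.prod μ) := by
  rw [integrable_prod_iff' (by fun_prop : Measurable _).aestronglyMeasurable]
  constructor
  · exact ae_of_all _ fun a => (hk.comp_sub_right (c a)).const_mul (g a)
  · have : ∀ a, ∫ x, ‖g a * k (x - c a)‖ = ‖g a‖ * ∫ x, ‖k x‖ := fun a => by
      simp only [norm_mul]
      rw [integral_const_mul, integral_sub_right_eq_self (fun x => ‖k x‖) (c a)]
    simp only [this]
    exact hg.norm.mul_const _

/-! ### The L² bound for conjugate Poisson transforms -/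

/-- The Poisson transform, without the factor `1/π`. -/
noncomputable def poisson (f : ℝ → ℝ) (y x : ℝ) : ℝ := ∫ t, f t * (y / ((x - t) ^ 2 + y ^ 2))

/-- The conjugate Poisson transform, without the factor `1/π`. -/
noncomputable def conjPoisson (f : ℝ → ℝ) (y x : ℝ) : ℝ :=
  ∫ t, f t * ((x - t) / ((x - t) ^ 2 + y ^ 2))

section

variable {f : ℝ → ℝ} {α β : ℝ}

theorem integrable_of_bounded_support {E : Type*} [NormedAddCommGroup E] {f : ℝ → E}
    (hf : AEStronglyMeasurable f) (hb : ∀ t, ‖f t‖ ≤ 1)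
    (hs : ∀ t, t ∉ Set.Ioo α β → f t = 0) : Integrable f := by
  have : IntegrableOn f (Set.Ioo α β) :=
    Measure.integrableOn_of_bounded (M := 1) (by simp) hf (ae_of_all _ hb)
  rwa [integrableOn_iff_integrable_of_support_subset] at this
  intro t ht
  by_contra h
  exact ht (hs t h)

theorem integral_norm_le_of_bounded_support {E : Type*} [NormedAddCommGroup E] {f : ℝ → E}
    (hb : ∀ t, ‖f t‖ ≤ 1) (hαβ : α ≤ β)
    (hs : ∀ t, t ∉ Set.Ioo α β → f t = 0) : ∫ t, ‖f t‖ ≤ β - α := by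
  calc ∫ t, ‖f t‖ ≤ ∫ t, (Set.Ioo α β).indicator (fun _ => (1:ℝ)) t := by
        refine integral_mono_of_nonneg (ae_of_all _ fun t => norm_nonneg _) ?_
          (ae_of_all _ fun t => ?_)
        · exact (integrable_indicator_iff measurableSet_Ioo).2 (by simp)
        · by_cases h : t ∈ Set.Ioo α β
          · rw [Set.indicator_of_mem h]; exact hb t
          · simp [hs t h, h]
    _ = β - α := by
        rw [integral_indicator measurableSet_Ioo]
        simp [Measure.real, hαβ]

theorem measurable_conjPoisson (hf : Measurable f) (y : ℝ) : Measurable (conjPoisson f y) := by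
  have : StronglyMeasurable (Function.uncurry fun x t : ℝ =>
      f t * ((x - t) / ((x - t) ^ 2 + y ^ 2))) :=
    Measurable.stronglyMeasurable (by unfold Function.uncurry; fun_prop)
  exact this.integral_prod_right.measurable

theorem integrable_mul_poisson_kernel (hfi : Integrable f) {y : ℝ} (hy : 0 < y) (x : ℝ) :
    Integrable fun t => f t * (y / ((x - t) ^ 2 + y ^ 2)) := by
  refine hfi.mul_bdd (c := y⁻¹) (by fun_prop : Measurable _).aestronglyMeasurable
    (ae_of_all _ fun t => ?_)
  rw [Real.norm_of_nonneg (by positivity), div_le_iff₀ (by positivity), mul_add, inv_mul_eq_div,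
    inv_mul_eq_div]
  have : y ^ 2 / y = y := by field_simp
  have : 0 ≤ (x - t) ^ 2 / y := by positivity
  linarith

theorem integrable_mul_conjPoisson_kernel (hfi : Integrable f) {y : ℝ} (hy : 0 < y) (x : ℝ) :
    Integrable fun t => f t * ((x - t) / ((x - t) ^ 2 + y ^ 2)) := by
  refine hfi.mul_bdd (c := y⁻¹) (by fun_prop : Measurable _).aestronglyMeasurable
    (ae_of_all _ fun t => ?_)
  rw [Real.norm_eq_abs, abs_div, abs_of_pos (show 0 < (x - t) ^ 2 + y ^ 2 by positivity),
    div_le_iff₀ (by positivity), inv_mul_eq_div, le_div_iff₀ hy]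
  have := sq_nonneg (|x - t| - y)
  have h := sq_abs (x - t)
  nlinarith [abs_nonneg (x - t)]

theorem abs_poisson_le (hb : ∀ t, |f t| ≤ 1) {y : ℝ} (hy : 0 < y) (x : ℝ) :
    |poisson f y x| ≤ Real.pi := by
  have hi : Integrable fun t : ℝ => y / (t ^ 2 + y ^ 2) :=
    ((integrable_inv_sq_add_sq hy).const_mul y)
  calc |poisson f y x| ≤ ∫ t, |f t * (y / ((x - t) ^ 2 + y ^ 2))| := abs_integral_le_integral_abs
    _ ≤ ∫ t, y / ((x - t) ^ 2 + y ^ 2) := by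
        refine integral_mono_of_nonneg (ae_of_all _ fun t => abs_nonneg _)
          (hi.comp_sub_left x) (ae_of_all _ fun t => ?_)
        simp only
        have h0 : 0 ≤ y / ((x - t) ^ 2 + y ^ 2) := by positivity
        rw [abs_mul, abs_of_nonneg h0]
        exact mul_le_of_le_one_left h0 (hb t)
    _ = Real.pi := by
        rw [integral_sub_left_eq_self (fun u => y / (u ^ 2 + y ^ 2)) volume x, integral_poisson hy]

theorem integrable_poisson (hf : Measurable f) (hfi : Integrable f) {y : ℝ} (hy : 0 < y) :
    Integrable (poisson f y) ∧ ∫ x, |poisson f y x| ≤ Real.pi * ∫ t, |f t| := by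
  have hk : Integrable fun u : ℝ => y / (u ^ 2 + y ^ 2) :=
    (integrable_inv_sq_add_sq hy).const_mul y
  have hi := integrable_mul_translate hfi hf measurable_id hk (by fun_prop)
  have h1 : Integrable (poisson f y) := hi.integral_prod_left
  refine ⟨h1, ?_⟩
  calc ∫ x, |poisson f y x|
      ≤ ∫ x, ∫ t, |f t * (y / ((x - t) ^ 2 + y ^ 2))| := by
        refine integral_mono_of_nonneg (ae_of_all _ fun t => abs_nonneg _)
          hi.abs.integral_prod_left (ae_of_all _ fun x => abs_integral_le_integral_abs)
    _ = ∫ t, ∫ x, |f t * (y / ((x - t) ^ 2 + y ^ 2))| := integral_integral_swap hi.abs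
    _ = ∫ t, |f t| * Real.pi := by
        congr 1
        ext t
        have e : ∀ x, |f t * (y / ((x - t) ^ 2 + y ^ 2))| = |f t| * (y / ((x - t) ^ 2 + y ^ 2)) :=
          fun x => by
            rw [abs_mul, abs_of_nonneg (show 0 ≤ y / ((x - t) ^ 2 + y ^ 2) by positivity)]
        simp only [e]
        rw [integral_const_mul, integral_sub_right_eq_self (fun u => y / (u ^ 2 + y ^ 2)) t,
          integral_poisson hy]
    _ = Real.pi * ∫ t, |f t| := by rw [integral_mul_const, mul_comm]

/-- The conjugate Poisson transform and the Poisson transform have the same `L²` norm. -/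
theorem integral_conjPoisson_sq_sub (hf : Measurable f) (hfi : Integrable f) {y : ℝ} (hy : 0 < y) :
    Integrable (fun x => conjPoisson f y x ^ 2 - poisson f y x ^ 2) ∧
      ∫ x, (conjPoisson f y x ^ 2 - poisson f y x ^ 2) = 0 := by
  -- The difference of squares is written as a double integral over (t, s) against the cross kernel,
  -- so that integrating in x first gives zero.
  set Φ : ℝ → ℝ × ℝ → ℝ := fun x z => f z.1 * f z.2 *
    (((x - z.1) * (x - z.2) - y ^ 2) / (((x - z.1) ^ 2 + y ^ 2) * ((x - z.2) ^ 2 + y ^ 2))) with hΦ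
  have hg : Integrable (fun z : ℝ × ℝ => f z.1 * f z.2) (volume.prod volume) := hfi.mul_prod hfi
  have hgm : Measurable (fun z : ℝ × ℝ => f z.1 * f z.2) := by fun_prop
  have hk := integrable_inv_sq_add_sq hy
  have hi : Integrable (Function.uncurry Φ) (volume.prod (volume.prod volume)) := by
    have h1 := integrable_mul_translate hg hgm measurable_fst hk (by fun_prop)
    have h2 := integrable_mul_translate hg hgm measurable_snd hk (by fun_prop)
    refine (h1.norm.add h2.norm).mono' ?_ (ae_of_all _ fun z => ?_)
    · exact (by unfold Function.uncurry; simp only [hΦ]; fun_prop :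
        Measurable _).aestronglyMeasurable
    · simp only [Function.uncurry, hΦ, Pi.add_apply, norm_mul (f _ * f _)]
      rw [← mul_add, Real.norm_of_nonneg (r := (_ : ℝ)⁻¹) (by positivity),
        Real.norm_of_nonneg (r := (_ : ℝ)⁻¹) (by positivity)]
      exact mul_le_mul_of_nonneg_left (abs_cross_kernel_le hy _ _) (norm_nonneg _)
  have hval : ∀ x, ∫ z, Φ x z ∂(volume.prod volume) = conjPoisson f y x ^ 2 - poisson f y x ^ 2 := fun x => by
    have a1 := integrable_mul_conjPoisson_kernel hfi hy x
    have a2 := integrable_mul_poisson_kernel hfi hy x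
    rw [sq, sq, conjPoisson, poisson, ← integral_prod_mul, ← integral_prod_mul,
      ← integral_sub (a1.mul_prod a1) (a2.mul_prod a2)]
    congr 1
    ext z
    simp only [hΦ]
    have : (x - z.1) ^ 2 + y ^ 2 ≠ 0 := by positivity
    have : (x - z.2) ^ 2 + y ^ 2 ≠ 0 := by positivity
    field_simp
  constructor
  · simp only [← hval]
    exact hi.integral_prod_left
  · simp only [← hval]
    rw [integral_integral_swap hi]
    -- The vanishing of the cross integral was obtained off the diagonal, which is a null set.
    have hz : ∀ᵐ z : ℝ × ℝ ∂(volume.prod volume), z.1 ≠ z.2 := by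
      refine Measure.ae_prod_mem_iff_ae_ae_mem ?_ |>.2 ?_
      · exact (measurableSet_eq_fun measurable_fst measurable_snd).compl
      · refine ae_of_all _ fun t => ?_
        filter_upwards [Measure.ae_ne volume t] with s hs using hs.symm
    rw [integral_eq_zero_of_ae]
    filter_upwards [hz] with z hz
    simp only [hΦ, Pi.zero_apply]
    rw [integral_const_mul, integral_cross_kernel hy hz, mul_zero]

/-- The L² norm is that of the Poisson transform, bounded by (sup norm) · (L¹ norm) ≤ π · π(β - α).
What matters is that the bound is independent of y. -/
theorem integral_conjPoisson_sq_le (hf : Measurable f) (hb : ∀ t, |f t| ≤ 1) (hαβ : α ≤ β)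
    (hs : ∀ t, t ∉ Set.Ioo α β → f t = 0) {y : ℝ} (hy : 0 < y) :
    Integrable (fun x => conjPoisson f y x ^ 2) ∧
      ∫ x, conjPoisson f y x ^ 2 ≤ Real.pi ^ 2 * (β - α) := by
  have hfi := integrable_of_bounded_support hf.aestronglyMeasurable hb hs
  obtain ⟨h1, h2⟩ := integral_conjPoisson_sq_sub hf hfi hy
  obtain ⟨h3, h4⟩ := integrable_poisson hf hfi hy
  have h5 : Integrable (fun x => poisson f y x ^ 2) := by
    simp only [sq]
    exact h3.bdd_mul h3.aestronglyMeasurable (ae_of_all _ (abs_poisson_le hb hy))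
  have h6 : Integrable (fun x => conjPoisson f y x ^ 2) := by
    refine (h1.add h5).congr (ae_of_all _ fun x => ?_)
    simp
  refine ⟨h6, ?_⟩
  rw [integral_sub h6 h5, sub_eq_zero] at h2
  rw [h2]
  calc ∫ x, poisson f y x ^ 2 ≤ ∫ x, Real.pi * |poisson f y x| := by
        refine integral_mono h5 (h3.abs.const_mul _) fun x => ?_
        simp only
        rw [← sq_abs, sq]
        exact mul_le_mul_of_nonneg_right (abs_poisson_le hb hy x) (abs_nonneg _)
    _ ≤ Real.pi * (Real.pi * (β - α)) := by
        rw [integral_const_mul]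
        refine mul_le_mul_of_nonneg_left (h4.trans ?_) Real.pi_pos.le
        exact mul_le_mul_of_nonneg_left (integral_norm_le_of_bounded_support hb hαβ hs)
          Real.pi_pos.le
    _ = Real.pi ^ 2 * (β - α) := by ring

end

/-! ### The logarithmic potential has locally bounded variation -/

/-- The logarithmic potential, a primitive of the Hilbert transform. -/
noncomputable def logPotential (f : ℝ → ℝ) (x : ℝ) : ℝ := ∫ t, f t * Real.log (x - t)

/-- The truncated classical Hilbert transform. -/
noncomputable def truncClassical (f : ℝ → ℝ) (ε x : ℝ) : ℝ :=
  ∫ t in {t : ℝ | ε < |t - x|}, f t / (x - t)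

section

variable {f : ℝ → ℝ} {α β : ℝ}

theorem integrable_mul_of_locallyIntegrable (hf : Measurable f) (hb : ∀ t, |f t| ≤ 1)
    (hs : ∀ t, t ∉ Set.Ioo α β → f t = 0) {k : ℝ → ℝ} (hk : IntegrableOn k (Set.Ioo α β)) :
    Integrable fun t => f t * k t := by
  have h1 : IntegrableOn (fun t => f t * k t) (Set.Ioo α β) :=
    Integrable.bdd_mul (c := 1) hk hf.aestronglyMeasurable (ae_of_all _ hb)
  rwa [integrableOn_iff_integrable_of_support_subset] at h1
  intro t ht
  by_contra h
  exact ht (by simp [hs t h])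

theorem integrableOn_log_sub (α β x : ℝ) :
    IntegrableOn (fun t => Real.log (x - t)) (Set.Ioo α β) := by
  rcases le_or_gt α β with h | h
  · have h1 : IntervalIntegrable Real.log volume (x - α) (x - β) := intervalIntegral.intervalIntegrable_log'
    have h2 := h1.comp_sub_left x
    simp only [sub_sub_cancel] at h2
    rw [intervalIntegrable_iff_integrableOn_Ioo_of_le h] at h2
    exact h2
  · simp [Set.Ioo_eq_empty_of_le h.le]

theorem integrable_mul_log (hf : Measurable f) (hb : ∀ t, |f t| ≤ 1)
    (hs : ∀ t, t ∉ Set.Ioo α β → f t = 0) (x : ℝ) :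
    Integrable fun t => f t * Real.log (x - t) :=
  integrable_mul_of_locallyIntegrable hf hb hs (integrableOn_log_sub α β x)

/-- A majorant independent of y, for dominated convergence as y → 0. Below, monotonicity of the
logarithm is used; above, log w ≤ w - 1 with y² ≤ 1 absorbing the constant. -/
theorem abs_half_log_le {u y : ℝ} (hu : u ≠ 0) (hy : |y| ≤ 1) :
    |Real.log (u ^ 2 + y ^ 2) / 2| ≤ |Real.log u| + u ^ 2 := by
  have h0 : 0 < u ^ 2 := by positivity
  have hy2 : y ^ 2 ≤ 1 := (sq_le_one_iff_abs_le_one y).2 hy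
  have h1 : Real.log (u ^ 2) ≤ Real.log (u ^ 2 + y ^ 2) :=
    Real.log_le_log h0 (by nlinarith [sq_nonneg y])
  have h2 : Real.log (u ^ 2 + y ^ 2) ≤ u ^ 2 := by
    have := Real.log_le_sub_one_of_pos (show 0 < u ^ 2 + y ^ 2 by positivity)
    linarith
  rw [Real.log_pow] at h1
  push_cast at h1
  rw [abs_le]
  constructor
  · have := neg_abs_le (Real.log u)
    linarith
  · have := abs_nonneg (Real.log u)
    linarith

/-- In x the kernel has the primitive ½ log((x - t)² + y²); the rest is Fubini, with the kernel
bounded by 1/y. -/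
theorem integral_conjPoisson (hf : Measurable f) (hfi : Integrable f) {y : ℝ} (hy : 0 < y)
    (a b : ℝ) : ∫ x in a..b, conjPoisson f y x =
      ∫ t, f t * (Real.log ((b - t) ^ 2 + y ^ 2) / 2 - Real.log ((a - t) ^ 2 + y ^ 2) / 2) := by
  have hbd : ∀ x t : ℝ, |(x - t) / ((x - t) ^ 2 + y ^ 2)| ≤ y⁻¹ := fun x t => by
    rw [abs_div, abs_of_pos (show 0 < (x - t) ^ 2 + y ^ 2 by positivity),
      div_le_iff₀ (by positivity), inv_mul_eq_div, le_div_iff₀ hy]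
    have := sq_nonneg (|x - t| - y)
    have h := sq_abs (x - t)
    nlinarith [abs_nonneg (x - t)]
  unfold conjPoisson
  rw [MeasureTheory.intervalIntegral_integral_swap]
  · congr 1
    ext t
    rw [intervalIntegral.integral_const_mul]
    congr 1
    have hd : ∀ x : ℝ, HasDerivAt (fun x : ℝ => Real.log ((x - t) ^ 2 + y ^ 2) / 2)
        ((x - t) / ((x - t) ^ 2 + y ^ 2)) x := fun x => by
      have h1 : HasDerivAt (fun x : ℝ => (x - t) ^ 2 + y ^ 2) (2 * (x - t)) x := by
        have := (((hasDerivAt_id x).sub_const t).pow 2).add_const (y ^ 2)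
        simpa using this
      have h2 : (x - t) ^ 2 + y ^ 2 ≠ 0 := by positivity
      refine ((h1.log h2).div_const 2).congr_deriv ?_
      field_simp
    rw [intervalIntegral.integral_eq_sub_of_hasDerivAt (fun x _ => hd x)]
    refine Continuous.intervalIntegrable ?_ _ _
    have : ∀ x : ℝ, (x - t) ^ 2 + y ^ 2 ≠ 0 := fun x => by positivity
    fun_prop (disch := assumption)
  · have hm : Measurable (Function.uncurry fun x t : ℝ => f t * ((x - t) / ((x - t) ^ 2 + y ^ 2))) := by
      unfold Function.uncurry
      fun_prop
    have : IsFiniteMeasure (volume.restrict (Set.uIoc a b)) := ⟨by simp [Set.uIoc]⟩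
    have h1 : Integrable (fun z : ℝ × ℝ => (1 : ℝ) * f z.2)
        ((volume.restrict (Set.uIoc a b)).prod volume) :=
      (integrable_const (1:ℝ)).mul_prod hfi
    refine (h1.norm.const_mul y⁻¹).mono' hm.aestronglyMeasurable (ae_of_all _ fun z => ?_)
    simp only [Function.uncurry, one_mul, norm_mul]
    rw [mul_comm]
    exact mul_le_mul_of_nonneg_right (hbd _ _) (norm_nonneg _)

/-- As y → 0 the smoothed logarithm ½ log(u² + y²) tends to `Real.log u`, which is log |u|, for u ≠
0 of either sign. -/
theorem tendsto_integral_conjPoisson (hf : Measurable f) (hb : ∀ t, |f t| ≤ 1)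
    (hs : ∀ t, t ∉ Set.Ioo α β → f t = 0) (a b : ℝ) :
    Tendsto (fun n : ℕ => ∫ x in a..b, conjPoisson f (1 / ((n : ℝ) + 1)) x) atTop
      (𝓝 (logPotential f b - logPotential f a)) := by
  have hfi := integrable_of_bounded_support hf.aestronglyMeasurable hb hs
  have hy : ∀ n : ℕ, (0 : ℝ) < 1 / ((n : ℝ) + 1) := fun n => by positivity
  have hy1 : ∀ n : ℕ, |1 / ((n : ℝ) + 1)| ≤ 1 := fun n => by
    rw [abs_of_pos (hy n), div_le_one (by positivity)]
    have : (0 : ℝ) ≤ n := by positivity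
    linarith
  simp only [integral_conjPoisson hf hfi (hy _)]
  rw [logPotential, logPotential,
    ← integral_sub (integrable_mul_log hf hb hs b) (integrable_mul_log hf hb hs a)]
  have hbound : ∀ x : ℝ, Integrable fun t => f t * (|Real.log (x - t)| + (x - t) ^ 2) := fun x => by
    refine integrable_mul_of_locallyIntegrable hf hb hs ((integrableOn_log_sub α β x).abs.add ?_)
    have : Continuous fun t : ℝ => (x - t) ^ 2 := by fun_prop
    exact this.integrableOn_Icc.mono_set Set.Ioo_subset_Icc_self
  have hne : ∀ x : ℝ, ∀ᵐ t : ℝ, x - t ≠ 0 := fun x => by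
    filter_upwards [Measure.ae_ne volume x] with t ht using sub_ne_zero.2 ht.symm
  refine tendsto_integral_of_dominated_convergence (fun t => |f t * (|Real.log (b - t)| + (b - t) ^ 2)|
    + |f t * (|Real.log (a - t)| + (a - t) ^ 2)|) (fun n => ?_)
    ((hbound b).abs.add (hbound a).abs) (fun n => ?_) ?_
  · exact (by fun_prop : Measurable _).aestronglyMeasurable
  · filter_upwards [hne a, hne b] with t ha hb'
    rw [norm_mul, abs_mul, abs_mul, ← mul_add, ← Real.norm_eq_abs]
    refine mul_le_mul_of_nonneg_left ?_ (norm_nonneg _)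
    refine (norm_sub_le _ _).trans (add_le_add ?_ ?_)
    · exact (abs_half_log_le hb' (hy1 n)).trans (le_abs_self _)
    · exact (abs_half_log_le ha (hy1 n)).trans (le_abs_self _)
  · filter_upwards [hne a, hne b] with t ha hb'
    have key : ∀ u : ℝ, u ≠ 0 → Tendsto (fun n : ℕ =>
        Real.log (u ^ 2 + (1 / ((n : ℝ) + 1)) ^ 2) / 2) atTop (𝓝 (Real.log u)) := fun u hu => by
      have h0 : Tendsto (fun n : ℕ => u ^ 2 + (1 / ((n : ℝ) + 1)) ^ 2) atTop (𝓝 (u ^ 2)) := by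
        have := (tendsto_one_div_add_atTop_nhds_zero_nat (𝕜 := ℝ)).pow 2 |>.const_add (u ^ 2)
        simpa using this
      have h1 := ((Real.continuousAt_log (pow_ne_zero 2 hu)).tendsto.comp h0).div_const 2
      rw [Real.log_pow] at h1
      push_cast at h1
      rwa [mul_div_cancel_left₀ _ two_ne_zero] at h1
    rw [← mul_sub]
    exact ((key _ hb').sub (key _ ha)).const_mul _

/-- A variation sum is the limit, as y → 0, of sums of |∫ V| over the pieces of a partition, with V
the conjugate Poisson transform. These are at most ∫ (1 + V²) over [a, b], which is bounded
uniformly in y. Differentiability almost everywhere follows. -/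
theorem locallyBoundedVariationOn_logPotential (hf : Measurable f) (hb : ∀ t, |f t| ≤ 1)
    (hαβ : α ≤ β) (hs : ∀ t, t ∉ Set.Ioo α β → f t = 0) :
    LocallyBoundedVariationOn (logPotential f) Set.univ := by
  intro a b _ _
  have hU : ∀ {y : ℝ}, 0 < y → ∀ c d : ℝ, IntervalIntegrable (conjPoisson f y) volume c d :=
    fun {y} hy c d => by
      obtain ⟨h1, -⟩ := integral_conjPoisson_sq_le hf hb hαβ hs hy
      rw [intervalIntegrable_iff]
      have h2 : IntegrableOn (fun x => 1 + conjPoisson f y x ^ 2) (Set.uIoc c d) :=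
        (integrableOn_const (by simp)).add h1.integrableOn
      refine h2.mono' (measurable_conjPoisson hf y).aestronglyMeasurable (ae_of_all _ fun x => ?_)
      rw [Real.norm_eq_abs, ← sq_abs (conjPoisson f y x)]
      nlinarith [sq_nonneg (|conjPoisson f y x| - 1), abs_nonneg (conjPoisson f y x)]
  suffices h : eVariationOn (logPotential f) (Set.univ ∩ Set.Icc a b) ≤
      ENNReal.ofReal ((b - a) + Real.pi ^ 2 * (β - α)) from ne_top_of_le_ne_top ENNReal.ofReal_ne_top h
  refine iSup_le ?_
  rintro ⟨n, u, hu, hmem⟩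
  have e : ∀ i, edist (logPotential f (u (i + 1))) (logPotential f (u i)) =
      ENNReal.ofReal |logPotential f (u (i + 1)) - logPotential f (u i)| := fun i => by
    rw [edist_dist, Real.dist_eq]
  simp only [e]
  rw [← ENNReal.ofReal_sum_of_nonneg (fun i _ => abs_nonneg _)]
  refine ENNReal.ofReal_le_ofReal ?_
  have hlim := tendsto_finsetSum (Finset.range n) fun i _ =>
    (tendsto_integral_conjPoisson hf hb hs (u i) (u (i + 1))).abs
  refine le_of_tendsto hlim (Eventually.of_forall fun m => ?_)
  set y : ℝ := 1 / ((m : ℝ) + 1) with hydef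
  have hy : 0 < y := by positivity
  obtain ⟨h1, h2⟩ := integral_conjPoisson_sq_le hf hb hαβ hs hy
  have hn : u 0 ≤ u n := hu (Nat.zero_le n)
  have ha0 : a ≤ u 0 := (hmem 0).2.1
  have hbn : u n ≤ b := (hmem n).2.2
  calc ∑ i ∈ Finset.range n, |∫ x in u i..u (i + 1), conjPoisson f y x|
      ≤ ∑ i ∈ Finset.range n, ∫ x in u i..u (i + 1), |conjPoisson f y x| :=
        Finset.sum_le_sum fun i _ =>
          intervalIntegral.abs_integral_le_integral_abs (hu (Nat.le_succ i))
    _ = ∫ x in u 0..u n, |conjPoisson f y x| :=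
        intervalIntegral.sum_integral_adjacent_intervals fun i _ => (hU hy _ _).abs
    _ ≤ ∫ x in u 0..u n, (1 + conjPoisson f y x ^ 2) := by
        refine intervalIntegral.integral_mono_on hn (hU hy _ _).abs ?_ fun x _ => ?_
        · exact intervalIntegrable_const.add h1.intervalIntegrable
        · rw [← sq_abs (conjPoisson f y x)]
          nlinarith [sq_nonneg (|conjPoisson f y x| - 1), abs_nonneg (conjPoisson f y x)]
    _ = (u n - u 0) + ∫ x in u 0..u n, conjPoisson f y x ^ 2 := by
        rw [intervalIntegral.integral_add intervalIntegrable_const h1.intervalIntegrable]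
        simp
    _ ≤ (b - a) + Real.pi ^ 2 * (β - α) := by
        refine add_le_add (by linarith) (le_trans ?_ h2)
        rw [intervalIntegral.integral_of_le hn]
        exact setIntegral_le_integral h1 (ae_of_all _ fun x => sq_nonneg _)

theorem integral_rescale (f ψ : ℝ → ℝ) (x : ℝ) {ε : ℝ} (hε : 0 < ε) :
    ∫ u, f (x - ε * u) * ψ u = ∫ t, f t * (ε⁻¹ * ψ ((x - t) / ε)) := by
  have h1 := Measure.integral_comp_mul_left (fun v => f (x - v) * ψ (v / ε)) ε
  have h2 := integral_sub_left_eq_self (fun v => f v * ψ ((x - v) / ε)) volume x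
  simp only [sub_sub_cancel] at h2
  rw [h2, abs_of_pos (inv_pos.2 hε), smul_eq_mul, ← integral_const_mul] at h1
  calc _ = ∫ u, f (x - ε * u) * ψ (ε * u / ε) := by
        simp only [mul_div_cancel_left₀ _ hε.ne']
    _ = _ := by
        rw [h1]
        congr 1
        ext t
        ring

theorem integral_odd {ψ : ℝ → ℝ} (h : ∀ u, ψ (-u) = -ψ u) : ∫ u, ψ u = 0 := by
  have h1 := integral_neg_eq_self ψ volume
  simp only [h, integral_neg] at h1
  linarith

/-! ### Odd integrable comparison kernels -/

/-- The truncated Hilbert kernel minus the conjugate Poisson kernel, at scale one. -/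
noncomputable def truncDiff (u : ℝ) : ℝ :=
  {u : ℝ | 1 < |u|}.indicator (fun u => 1 / u) u - u / (u ^ 2 + 1)

/-- A symmetric difference quotient of the logarithm minus the conjugate Poisson kernel, at scale
one. -/
noncomputable def logDiff (u : ℝ) : ℝ :=
  (Real.log (u + 1) - Real.log (u - 1)) / 2 - u / (u ^ 2 + 1)

theorem measurable_truncDiff : Measurable truncDiff := by
  unfold truncDiff
  refine Measurable.sub (Measurable.indicator (by fun_prop) ?_) (by fun_prop)
  exact measurableSet_lt measurable_const measurable_id.abs

theorem measurable_logDiff : Measurable logDiff := by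
  unfold logDiff
  fun_prop

theorem truncDiff_neg (u : ℝ) : truncDiff (-u) = -truncDiff u := by
  unfold truncDiff
  by_cases h : 1 < |u|
  · rw [Set.indicator_of_mem (show u ∈ {u : ℝ | 1 < |u|} from h),
      Set.indicator_of_mem (show -u ∈ {u : ℝ | 1 < |u|} by simpa using h)]
    rw [neg_sq, neg_div]
    ring
  · rw [Set.indicator_of_notMem (show u ∉ {u : ℝ | 1 < |u|} from h),
      Set.indicator_of_notMem (show -u ∉ {u : ℝ | 1 < |u|} by simpa using h)]
    rw [neg_sq, neg_div]
    ring

theorem logDiff_neg (u : ℝ) : logDiff (-u) = -logDiff u := by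
  unfold logDiff
  rw [show -u + 1 = -(u - 1) by ring, show -u - 1 = -(u + 1) by ring, Real.log_neg_eq_log,
    Real.log_neg_eq_log, neg_sq, neg_div]
  ring

theorem abs_div_sq_add_one_le (u : ℝ) : |u / (u ^ 2 + 1)| ≤ 1 := by
  rw [abs_div, abs_of_pos (show 0 < u ^ 2 + 1 by positivity), div_le_one (by positivity)]
  have := sq_abs u
  nlinarith [sq_nonneg (|u| - 1)]

theorem abs_one_div_sub_le {u : ℝ} (hu : 1 ≤ u) : |1 / u - u / (u ^ 2 + 1)| ≤ (1 + u ^ 2)⁻¹ := by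
  have h0 : 0 < u := by linarith
  have e : 1 / u - u / (u ^ 2 + 1) = (1 + u ^ 2)⁻¹ * u⁻¹ := by
    field_simp
    ring
  rw [e, abs_of_nonneg (by positivity)]
  exact mul_le_of_le_one_right (by positivity) (inv_le_one_of_one_le₀ hu)

theorem integrable_truncDiff : Integrable truncDiff := by
  refine (integrable_inv_one_add_sq.const_mul 2).mono' measurable_truncDiff.aestronglyMeasurable
    (ae_of_all _ fun u => ?_)
  rw [Real.norm_eq_abs]
  wlog hu : 0 ≤ u generalizing u
  · have := this (-u) (by linarith)
    rwa [truncDiff_neg, abs_neg, neg_sq] at this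
  unfold truncDiff
  have hp : 0 ≤ (1 + u ^ 2)⁻¹ := by positivity
  by_cases h : 1 < |u|
  · rw [Set.indicator_of_mem (show u ∈ {u : ℝ | 1 < |u|} from h)]
    rw [abs_of_nonneg hu] at h
    linarith [abs_one_div_sub_le h.le]
  · rw [Set.indicator_of_notMem (show u ∉ {u : ℝ | 1 < |u|} from h)]
    rw [not_lt, abs_of_nonneg hu] at h
    rw [zero_sub, abs_neg, abs_of_nonneg (by positivity), div_eq_mul_inv, add_comm (u ^ 2)]
    exact mul_le_mul_of_nonneg_right (by linarith) hp

/-- The bounds 1 - 1/w ≤ log w ≤ w - 1 at w = (u ± 1)/u show that the halved logarithmic difference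
is 1/u + O(u⁻²), and the conjugate Poisson kernel is also 1/u + O(u⁻²). -/
theorem abs_logDiff_le {u : ℝ} (hu : 2 ≤ u) : |logDiff u| ≤ 6 * (1 + u ^ 2)⁻¹ := by
  have h0 : 0 < u := by linarith
  have h1 : 0 < u - 1 := by linarith
  have e1 : Real.log (u + 1) = Real.log u + Real.log ((u + 1) / u) := by
    rw [Real.log_div (by linarith) h0.ne']
    ring
  have e2 : Real.log (u - 1) = Real.log u + Real.log ((u - 1) / u) := by
    rw [Real.log_div h1.ne' h0.ne']
    ring
  have a1 := Real.log_le_sub_one_of_pos (show 0 < (u + 1) / u by positivity)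
  have a2 := Real.one_sub_inv_le_log_of_pos (show 0 < (u + 1) / u by positivity)
  have a3 := Real.log_le_sub_one_of_pos (show 0 < (u - 1) / u by positivity)
  have a4 := Real.one_sub_inv_le_log_of_pos (show 0 < (u - 1) / u by positivity)
  rw [inv_div] at a2 a4
  have b1 : (u + 1) / u - 1 = 1 / u := by field_simp; ring
  have b2 : 1 - u / (u + 1) = 1 / u - 1 / (u * (u + 1)) := by field_simp; ring
  have b3 : (u - 1) / u - 1 = - (1 / u) := by field_simp; ring
  have b4 : 1 - u / (u - 1) = - (1 / u) - 1 / (u * (u - 1)) := by field_simp; ring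
  have c1 : 1 / (u * (u + 1)) ≤ 5 * (1 + u ^ 2)⁻¹ := by
    rw [← div_eq_mul_inv, div_le_div_iff₀ (by positivity) (by positivity)]
    nlinarith
  have c2 : 1 / (u * (u - 1)) ≤ 5 * (1 + u ^ 2)⁻¹ := by
    rw [← div_eq_mul_inv, div_le_div_iff₀ (by positivity) (by positivity)]
    nlinarith
  have d := abs_le.1 (abs_one_div_sub_le (show 1 ≤ u by linarith))
  have hp : 0 ≤ (1 + u ^ 2)⁻¹ := by positivity
  unfold logDiff
  rw [abs_le]
  constructor <;> linarith [d.1, d.2]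

/-- The singularities at ±1 are logarithmic and the decay is quadratic. Since the kernel is
unbounded at ±1, it has no bounded radially decreasing majorant, hence the need for an approximate
identity theorem for arbitrary integrable kernels. -/
theorem integrable_logDiff : Integrable logDiff := by
  have hloc : IntegrableOn logDiff (Set.Ioo (-2) 2) := by
    have h1 : ∀ c : ℝ, IntegrableOn (fun u => Real.log (u - c)) (Set.Ioo (-2) 2) := fun c => by
      have := integrableOn_log_sub (-2) 2 c
      refine this.congr (ae_of_all _ fun u => ?_)
      simp only
      rw [← Real.log_neg_eq_log, neg_sub]
    have h2 : IntegrableOn (fun u : ℝ => u / (u ^ 2 + 1)) (Set.Ioo (-2) 2) :=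
      Measure.integrableOn_of_bounded (M := 1) (by simp)
        (by fun_prop : Measurable _).aestronglyMeasurable (ae_of_all _ abs_div_sq_add_one_le)
    have h3 := (((h1 (-1)).sub (h1 1)).div_const 2).sub h2
    refine h3.congr (ae_of_all _ fun u => ?_)
    simp [logDiff]
  have hfar : IntegrableOn logDiff (Set.Ioo (-2) 2)ᶜ := by
    refine (integrable_inv_one_add_sq.const_mul 6).integrableOn.mono'
      measurable_logDiff.aestronglyMeasurable ?_
    filter_upwards [ae_restrict_mem measurableSet_Ioo.compl] with u hu
    rw [Real.norm_eq_abs]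
    rcases le_total 0 u with h | h
    · refine abs_logDiff_le ?_
      by_contra h'
      exact hu ⟨by linarith, by linarith⟩
    · have := abs_logDiff_le (u := -u) (by
        by_contra h'
        exact hu ⟨by linarith, by linarith⟩)
      rwa [logDiff_neg, abs_neg, neg_sq] at this
  have := hloc.union hfar
  rwa [Set.union_compl_self, integrableOn_univ] at this

end

/-! ### Almost everywhere existence of the classical Hilbert transform -/

section

variable {f : ℝ → ℝ} {α β : ℝ}

theorem integrable_mul_trunc_kernel (hfi : Integrable f) {ε : ℝ} (hε : 0 < ε) (x : ℝ) :
    Integrable fun t => f t * ({t : ℝ | ε < |t - x|}.indicator (fun t => 1 / (x - t)) t) := by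
  have hS : MeasurableSet {t : ℝ | ε < |t - x|} :=
    measurableSet_lt measurable_const (measurable_id.sub_const x).abs
  refine hfi.mul_bdd (c := ε⁻¹) ?_ (ae_of_all _ fun t => ?_)
  · exact (Measurable.indicator (by fun_prop) hS).aestronglyMeasurable
  · by_cases h : ε < |t - x|
    · rw [Set.indicator_of_mem (show t ∈ {t : ℝ | ε < |t - x|} from h), norm_div, norm_one,
        one_div, Real.norm_eq_abs, abs_sub_comm]
      exact inv_anti₀ hε h.le
    · rw [Set.indicator_of_notMem (show t ∉ {t : ℝ | ε < |t - x|} from h), norm_zero]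
      positivity

theorem truncClassical_eq (f : ℝ → ℝ) (ε x : ℝ) : truncClassical f ε x =
    ∫ t, f t * ({t : ℝ | ε < |t - x|}.indicator (fun t => 1 / (x - t)) t) := by
  have hS : MeasurableSet {t : ℝ | ε < |t - x|} :=
    measurableSet_lt measurable_const (measurable_id.sub_const x).abs
  rw [truncClassical, ← integral_indicator hS]
  congr 1
  ext t
  by_cases h : t ∈ {t : ℝ | ε < |t - x|}
  · rw [Set.indicator_of_mem h, Set.indicator_of_mem h, mul_one_div]
  · rw [Set.indicator_of_notMem h, Set.indicator_of_notMem h, mul_zero]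

theorem integral_truncDiff_rescale (hfi : Integrable f) (x : ℝ) {ε : ℝ} (hε : 0 < ε) :
    ∫ u, f (x - ε * u) * truncDiff u = truncClassical f ε x - conjPoisson f ε x := by
  rw [integral_rescale _ _ _ hε, truncClassical_eq, conjPoisson, ← integral_sub
    (integrable_mul_trunc_kernel hfi hε x) (integrable_mul_conjPoisson_kernel hfi hε x)]
  congr 1
  ext t
  rw [← mul_sub]
  congr 1
  unfold truncDiff
  have e : ε⁻¹ * ((x - t) / ε / (((x - t) / ε) ^ 2 + 1)) = (x - t) / ((x - t) ^ 2 + ε ^ 2) := by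
    have : (x - t) ^ 2 + ε ^ 2 ≠ 0 := by positivity
    field_simp
  rw [mul_sub, e]
  congr 1
  have hiff : t ∈ {t : ℝ | ε < |t - x|} ↔ (x - t) / ε ∈ {u : ℝ | 1 < |u|} := by
    simp only [Set.mem_ofPred_eq]
    rw [abs_div, abs_of_pos hε, one_lt_div hε, abs_sub_comm]
  by_cases h : t ∈ {t : ℝ | ε < |t - x|}
  · rw [Set.indicator_of_mem h, Set.indicator_of_mem (hiff.1 h)]
    field_simp
  · rw [Set.indicator_of_notMem h, Set.indicator_of_notMem (fun h' => h (hiff.2 h')), mul_zero]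

theorem integral_logDiff_rescale (hf : Measurable f) (hb : ∀ t, |f t| ≤ 1)
    (hs : ∀ t, t ∉ Set.Ioo α β → f t = 0) (x : ℝ) {ε : ℝ} (hε : 0 < ε) :
    ∫ u, f (x - ε * u) * logDiff u =
      (logPotential f (x + ε) - logPotential f (x - ε)) / (2 * ε) - conjPoisson f ε x := by
  have hfi := integrable_of_bounded_support hf.aestronglyMeasurable hb hs
  have i1 := integrable_mul_log hf hb hs (x + ε)
  have i2 := integrable_mul_log hf hb hs (x - ε)
  have i3 : Integrable fun t =>
      (f t * Real.log (x + ε - t) - f t * Real.log (x - ε - t)) / (2 * ε) := (i1.sub i2).div_const _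
  rw [integral_rescale _ _ _ hε, logPotential, logPotential, ← integral_sub i1 i2,
    ← integral_div, conjPoisson, ← integral_sub i3 (integrable_mul_conjPoisson_kernel hfi hε x)]
  refine integral_congr_ae ?_
  -- At t = x ± ε the convention log 0 = 0 can break the splitting of the logarithm of a quotient.
  -- Elsewhere the two terms log ε cancel.
  filter_upwards [Measure.ae_ne volume (x + ε), Measure.ae_ne volume (x - ε)] with t h1 h2
  unfold logDiff
  have e : ε⁻¹ * ((x - t) / ε / (((x - t) / ε) ^ 2 + 1)) = (x - t) / ((x - t) ^ 2 + ε ^ 2) := by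
    have : (x - t) ^ 2 + ε ^ 2 ≠ 0 := by positivity
    field_simp
  have e1 : Real.log ((x - t) / ε + 1) = Real.log (x + ε - t) - Real.log ε := by
    rw [← Real.log_div (sub_ne_zero.2 h1.symm) hε.ne']
    congr 1
    field_simp
    ring
  have e2 : Real.log ((x - t) / ε - 1) = Real.log (x - ε - t) - Real.log ε := by
    rw [← Real.log_div (sub_ne_zero.2 h2.symm) hε.ne']
    congr 1
    field_simp
    ring
  rw [mul_sub ε⁻¹, e, e1, e2]
  field_simp
  ring

theorem tendsto_symmetric_quotient {G : ℝ → ℝ} {x g : ℝ} (h : HasDerivAt G g x) :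
    Tendsto (fun ε => (G (x + ε) - G (x - ε)) / (2 * ε)) (𝓝[>] 0) (𝓝 g) := by
  have h1 := h.tendsto_slope_zero_right
  have hneg : Tendsto (fun ε : ℝ => -ε) (𝓝[>] 0) (𝓝[<] 0) := by
    have := tendsto_neg_nhdsGT (a := (0 : ℝ))
    rwa [neg_zero] at this
  have h2 := h.tendsto_slope_zero_left.comp hneg
  have h3 := (h1.add h2).div_const 2
  rw [add_self_div_two] at h3
  refine h3.congr' ?_
  filter_upwards [self_mem_nhdsWithin] with ε hε
  have hε : (0 : ℝ) < ε := hε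
  simp only [Function.comp, smul_eq_mul, ← sub_eq_add_neg]
  field_simp
  ring

/-- Almost everywhere convergence of the truncated Hilbert transforms of a bounded function with
bounded support, with an `L²` bound for the limit. -/
theorem exists_classical_limit (hf : Measurable f) (hb : ∀ t, |f t| ≤ 1) (hαβ : α ≤ β)
    (hs : ∀ t, t ∉ Set.Ioo α β → f t = 0) : ∃ g : ℝ → ℝ, Measurable g ∧
      (∀ᵐ x, Tendsto (fun ε => truncClassical f ε x) (𝓝[>] 0) (𝓝 (g x))) ∧
      ∫⁻ x, ENNReal.ofReal (g x ^ 2) ≤ ENNReal.ofReal (Real.pi ^ 2 * (β - α)) := by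
  have hfi := integrable_of_bounded_support hf.aestronglyMeasurable hb hs
  have key : ∀ᵐ x, Tendsto (fun ε => conjPoisson f ε x) (𝓝[>] 0) (𝓝 (deriv (logPotential f) x)) ∧
      Tendsto (fun ε => truncClassical f ε x) (𝓝[>] 0) (𝓝 (deriv (logPotential f) x)) := by
    filter_upwards [ae_tendsto_integral_approx hf hb,
      (locallyBoundedVariationOn_logPotential hf hb hαβ hs).ae_differentiableAt] with x hx hd
    have h1 := hx _ measurable_truncDiff integrable_truncDiff
    have h2 := hx _ measurable_logDiff integrable_logDiff
    -- Both comparison kernels are odd, so the approximate identity limits f(x) ∫ ψ are zero.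
    rw [integral_odd truncDiff_neg, mul_zero] at h1
    rw [integral_odd logDiff_neg, mul_zero] at h2
    have hU : Tendsto (fun ε => conjPoisson f ε x) (𝓝[>] 0) (𝓝 (deriv (logPotential f) x)) := by
      have := (tendsto_symmetric_quotient hd.hasDerivAt).sub h2
      rw [sub_zero] at this
      refine this.congr' ?_
      filter_upwards [self_mem_nhdsWithin] with ε hε
      rw [integral_logDiff_rescale hf hb hs x hε, sub_sub_cancel]
    refine ⟨hU, ?_⟩
    have := h1.add hU
    rw [zero_add] at this
    refine this.congr' ?_
    filter_upwards [self_mem_nhdsWithin] with ε hε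
    rw [integral_truncDiff_rescale hfi x hε, sub_add_cancel]
  refine ⟨deriv (logPotential f), measurable_deriv _, key.mono fun x h => h.2, ?_⟩
  -- Fatou's lemma is applied along the sequence y = 1/(n + 1).
  have hseq : Tendsto (fun n : ℕ => 1 / ((n : ℝ) + 1)) atTop (𝓝[>] 0) :=
    tendsto_nhdsWithin_iff.2 ⟨tendsto_one_div_add_atTop_nhds_zero_nat,
      Eventually.of_forall fun n => Set.mem_Ioi.2 (by positivity)⟩
  calc ∫⁻ x, ENNReal.ofReal (deriv (logPotential f) x ^ 2)
      = ∫⁻ x, liminf (fun n : ℕ => ENNReal.ofReal (conjPoisson f (1 / ((n : ℝ) + 1)) x ^ 2)) atTop := by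
        refine lintegral_congr_ae ?_
        filter_upwards [key] with x hx
        have := (ENNReal.continuous_ofReal.tendsto _).comp ((hx.1.comp hseq).pow 2)
        exact this.liminf_eq.symm
    _ ≤ liminf (fun n : ℕ => ∫⁻ x, ENNReal.ofReal (conjPoisson f (1 / ((n : ℝ) + 1)) x ^ 2)) atTop :=
        lintegral_liminf_le fun n => ((measurable_conjPoisson hf _).pow_const 2).ennreal_ofReal
    _ ≤ ENNReal.ofReal (Real.pi ^ 2 * (β - α)) := by
        refine liminf_le_of_le (by isBoundedDefault) fun b hb' => ?_
        obtain ⟨n, hn⟩ := hb'.exists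
        refine hn.trans ?_
        obtain ⟨h1, h2⟩ := integral_conjPoisson_sq_le hf hb hαβ hs
          (show (0:ℝ) < 1 / ((n : ℝ) + 1) by positivity)
        rw [← ofReal_integral_eq_lintegral_ofReal h1 (ae_of_all _ fun x => sq_nonneg _)]
        exact ENNReal.ofReal_le_ofReal h2

end

theorem exists_classical_limit_complex {f : ℝ → ℂ} {α β : ℝ} (hf : Measurable f)
    (hb : ∀ t, ‖f t‖ ≤ 1) (hαβ : α ≤ β) (hs : ∀ t, t ∉ Set.Ioo α β → f t = 0) :
    ∃ g : ℝ → ℂ, Measurable g ∧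
      (∀ᵐ x : ℝ, Tendsto (fun ε : ℝ => ∫ t in {t : ℝ | ε < |t - x|}, f t * ((1 / (x - t) : ℝ) : ℂ))
        (𝓝[>] 0) (𝓝 (g x))) ∧
      ∫⁻ x, ENNReal.ofReal (‖g x‖ ^ 2) ≤ ENNReal.ofReal (2 * Real.pi ^ 2 * (β - α)) := by
  have hfi := integrable_of_bounded_support hf.aestronglyMeasurable hb hs
  obtain ⟨g₁, m₁, t₁, b₁⟩ := exists_classical_limit (f := fun t => (f t).re)
    (Complex.measurable_re.comp hf) (fun t => (Complex.abs_re_le_norm _).trans (hb t)) hαβ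
    (fun t ht => by simp [hs t ht])
  obtain ⟨g₂, m₂, t₂, b₂⟩ := exists_classical_limit (f := fun t => (f t).im)
    (Complex.measurable_im.comp hf) (fun t => (Complex.abs_im_le_norm _).trans (hb t)) hαβ
    (fun t ht => by simp [hs t ht])
  refine ⟨fun x => (g₁ x : ℂ) + (g₂ x : ℂ) * Complex.I, by fun_prop, ?_, ?_⟩
  · filter_upwards [t₁, t₂] with x h₁ h₂
    have := (Complex.continuous_ofReal.tendsto _).comp h₁ |>.add
      (((Complex.continuous_ofReal.tendsto _).comp h₂).mul_const Complex.I)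
    refine this.congr' ?_
    filter_upwards [self_mem_nhdsWithin] with ε hε
    have hε : (0 : ℝ) < ε := hε
    simp only [Function.comp, truncClassical]
    have hS : MeasurableSet {t : ℝ | ε < |t - x|} :=
      measurableSet_lt measurable_const (measurable_id.sub_const x).abs
    have hint : IntegrableOn (fun t => f t * ((1 / (x - t) : ℝ) : ℂ)) {t : ℝ | ε < |t - x|} := by
      refine hfi.integrableOn.mul_bdd (c := ε⁻¹) (by fun_prop : Measurable _).aestronglyMeasurable ?_
      filter_upwards [ae_restrict_mem hS] with t ht
      rw [Complex.norm_real, norm_div, norm_one, one_div, Real.norm_eq_abs, abs_sub_comm]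
      exact inv_anti₀ hε (le_of_lt ht)
    rw [← integral_re_add_im hint]
    simp only [RCLike.re_to_complex, RCLike.im_to_complex, RCLike.I_to_complex,
      Complex.re_mul_ofReal, Complex.im_mul_ofReal, mul_one_div, Complex.coe_algebraMap]
  · have e : ∀ x, ‖(g₁ x : ℂ) + (g₂ x : ℂ) * Complex.I‖ ^ 2 = g₁ x ^ 2 + g₂ x ^ 2 := fun x => by
      rw [Complex.sq_norm, Complex.normSq_add_mul_I]
    simp only [e]
    have e2 : ∀ x, ENNReal.ofReal (g₁ x ^ 2 + g₂ x ^ 2) =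
        ENNReal.ofReal (g₁ x ^ 2) + ENNReal.ofReal (g₂ x ^ 2) := fun x =>
      ENNReal.ofReal_add (sq_nonneg _) (sq_nonneg _)
    simp only [e2]
    rw [lintegral_add_left (by fun_prop)]
    refine (add_le_add b₁ b₂).trans ?_
    rw [← ENNReal.ofReal_add (mul_nonneg (sq_nonneg _) (sub_nonneg.2 hαβ))
      (mul_nonneg (sq_nonneg _) (sub_nonneg.2 hαβ))]
    exact ENNReal.ofReal_le_ofReal (by linarith)

/-! ### Geometry and size of the λ-Hilbert kernel -/

/-- The quadratic form in the denominator of the kernel. -/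
def quad (x t s : ℝ) : ℝ := x ^ 2 + t ^ 2 - 2 * x * t * s

/-- The weight in the kernel. -/
noncomputable def weight (lam s : ℝ) : ℝ := (1 + s) * (1 - s ^ 2) ^ (lam - 1)

/-- The integral in the kernel. -/
noncomputable def kernelIntegral (lam x t : ℝ) : ℝ :=
  ∫ s in (-1 : ℝ)..1, weight lam s / quad x t s ^ (lam + 1)

/-- The constant in the kernel. -/
noncomputable def kernelConst (lam : ℝ) : ℝ :=
  lam * Real.Gamma (lam + 1 / 2) / ((2 : ℝ) ^ (-lam - 1 / 2) * Real.pi)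

theorem hilbertKernel_eq (lam x t : ℝ) :
    hilbertKernel lam x t = kernelConst lam * (x - t) * kernelIntegral lam x t := rfl

/-- By the law of cosines `quad` is the squared third side of a triangle with sides |x|, |t| and
angle of cosine ±s; this is the triangle inequality. -/
theorem sq_le_quad (x t : ℝ) {s : ℝ} (h1 : -1 ≤ s) (h2 : s ≤ 1) :
    (|x| - |t|) ^ 2 ≤ quad x t s := by
  have h : x * t * s ≤ |x| * |t| := by
    calc x * t * s ≤ |x * t * s| := le_abs_self _
      _ = |x| * |t| * |s| := by rw [abs_mul, abs_mul]
      _ ≤ |x| * |t| * 1 := mul_le_mul_of_nonneg_left (abs_le.2 ⟨h1, h2⟩) (by positivity)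
      _ = _ := mul_one _
  unfold quad
  nlinarith [sq_abs x, sq_abs t]

theorem quad_pos {x t s : ℝ} (h1 : -1 ≤ s) (h2 : s ≤ 1) (h : |x| ≠ |t|) : 0 < quad x t s :=
  lt_of_lt_of_le (by have := sub_ne_zero.2 h; positivity) (sq_le_quad x t h1 h2)

/-- For equal signs `quad` can degenerate only at s = 1. The factor 1 - s is what gets traded
against the singular weight (1 - s)^(λ-1). -/
theorem quad_ge_of_nonneg {x t s : ℝ} (hx : 0 ≤ x * t) (h1 : -1 ≤ s) (h2 : s ≤ 1) :
    (1 - s) * ((x ^ 2 + t ^ 2) / 2) ≤ quad x t s := by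
  unfold quad
  nlinarith [mul_nonneg (by linarith : (0:ℝ) ≤ 1 + s) (sq_nonneg (x - t))]

theorem quad_ge_of_nonpos {x t s : ℝ} (hx : x * t ≤ 0) (h1 : -1 ≤ s) (h2 : s ≤ 1) :
    (1 + s) * ((x ^ 2 + t ^ 2) / 2) ≤ quad x t s := by
  unfold quad
  nlinarith [mul_nonneg (by linarith : (0:ℝ) ≤ 1 - s) (sq_nonneg (x + t))]

theorem weight_nonneg (lam : ℝ) {s : ℝ} (h1 : -1 ≤ s) (h2 : s ≤ 1) : 0 ≤ weight lam s :=
  mul_nonneg (by linarith) (Real.rpow_nonneg (by nlinarith) _)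

theorem weight_eq (lam : ℝ) {s : ℝ} (h1 : -1 < s) (h2 : s < 1) :
    weight lam s = (1 + s) ^ lam * (1 - s) ^ (lam - 1) := by
  have a : 0 < 1 + s := by linarith
  have b : 0 < 1 - s := by linarith
  rw [weight, show 1 - s ^ 2 = (1 + s) * (1 - s) by ring, Real.mul_rpow a.le b.le, ← mul_assoc]
  congr 1
  nth_rewrite 1 [← Real.rpow_one (1 + s)]
  rw [← Real.rpow_add a]
  congr 1
  ring

theorem intervalIntegrable_jacobi {a b : ℝ} (ha : -1 < a) (hb : -1 < b) :
    IntervalIntegrable (fun s : ℝ => (1 + s) ^ a * (1 - s) ^ b) volume (-1) 1 := by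
  have h1 : IntervalIntegrable (fun s : ℝ => (1 + s) ^ a) volume (-1) 0 := by
    have := (intervalIntegral.intervalIntegrable_rpow' (a := 0) (b := 1) ha).comp_add_left 1
    simpa using this
  have h2 : IntervalIntegrable (fun s : ℝ => (1 - s) ^ b) volume 0 1 := by
    have := (intervalIntegral.intervalIntegrable_rpow' (a := 1) (b := 0) hb).comp_sub_left 1
    simpa using this
  refine (h1.mul_continuousOn ?_).trans (h2.continuousOn_mul ?_)
  · intro s hs
    rw [Set.uIcc_of_le (by norm_num)] at hs
    have : 1 - s ≠ 0 := by linarith [hs.2]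
    exact ((by fun_prop : ContinuousAt (fun s : ℝ => 1 - s) s).rpow_const
      (Or.inl this)).continuousWithinAt
  · intro s hs
    rw [Set.uIcc_of_le (by norm_num)] at hs
    have : 1 + s ≠ 0 := by linarith [hs.1]
    exact ((by fun_prop : ContinuousAt (fun s : ℝ => 1 + s) s).rpow_const
      (Or.inl this)).continuousWithinAt

/-- Interval integrals over `[-1, 1]` only see the open interval. -/
theorem ae_uIoc_neg_one_one {P : ℝ → Prop} (h : ∀ s : ℝ, -1 < s → s < 1 → P s) :
    ∀ᵐ s ∂(volume.restrict (Set.uIoc (-1 : ℝ) 1)), P s := by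
  rw [Set.uIoc_of_le (by norm_num), ← restrict_Ioo_eq_restrict_Ioc]
  filter_upwards [ae_restrict_mem measurableSet_Ioo] with s hs using h s hs.1 hs.2

theorem intervalIntegrable_of_le {F G : ℝ → ℝ} (hG : IntervalIntegrable G volume (-1) 1)
    (hF : Measurable F) (h : ∀ s : ℝ, -1 < s → s < 1 → |F s| ≤ G s) :
    IntervalIntegrable F volume (-1) 1 := by
  rw [intervalIntegrable_iff] at hG ⊢
  exact hG.mono' hF.aestronglyMeasurable (ae_uIoc_neg_one_one h)

theorem integral_le_of_le {F G : ℝ → ℝ} (hF : IntervalIntegrable F volume (-1) 1)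
    (hG : IntervalIntegrable G volume (-1) 1)
    (h : ∀ s : ℝ, -1 < s → s < 1 → F s ≤ G s) : ∫ s in (-1 : ℝ)..1, F s ≤ ∫ s in (-1 : ℝ)..1, G s := by
  rw [intervalIntegral.integral_of_le (by norm_num), intervalIntegral.integral_of_le (by norm_num)]
  refine integral_mono_ae hF.1 hG.1 ?_
  have := ae_uIoc_neg_one_one h
  rwa [Set.uIoc_of_le (by norm_num)] at this

theorem intervalIntegrable_weight {lam : ℝ} (hl : 0 < lam) :
    IntervalIntegrable (weight lam) volume (-1) 1 := by
  refine intervalIntegrable_of_le (intervalIntegrable_jacobi (by linarith : -1 < lam)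
    (by linarith : -1 < lam - 1)) (by unfold weight; fun_prop) fun s h1 h2 => ?_
  rw [abs_of_nonneg (weight_nonneg lam h1.le h2.le), weight_eq lam h1 h2]

theorem intervalIntegrable_div_quad (lam : ℝ) {x t : ℝ} (h : |x| ≠ |t|) {w : ℝ → ℝ}
    (hw : IntervalIntegrable w volume (-1) 1) :
    IntervalIntegrable (fun s => w s / quad x t s ^ (lam + 1)) volume (-1) 1 := by
  simp only [div_eq_mul_inv]
  refine hw.mul_continuousOn fun s hs => ?_
  rw [Set.uIcc_of_le (by norm_num)] at hs
  have hq := quad_pos hs.1 hs.2 h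
  refine ContinuousAt.continuousWithinAt ?_
  refine ContinuousAt.inv₀ (ContinuousAt.rpow_const ?_ (Or.inl hq.ne'))
    (Real.rpow_pos_of_pos hq _).ne'
  unfold quad
  fun_prop

theorem kernelIntegral_nonneg (lam x t : ℝ) : 0 ≤ kernelIntegral lam x t := by
  refine intervalIntegral.integral_nonneg (by norm_num) fun s hs => ?_
  refine div_nonneg (weight_nonneg lam hs.1 hs.2) (Real.rpow_nonneg ?_ _)
  exact (sq_nonneg _).trans (sq_le_quad x t hs.1 hs.2)

theorem measurable_kernelIntegral (lam x : ℝ) : Measurable (kernelIntegral lam x) := by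
  unfold kernelIntegral
  simp only [intervalIntegral.integral_of_le (show (-1 : ℝ) ≤ 1 by norm_num)]
  have : StronglyMeasurable (Function.uncurry fun t s : ℝ =>
      weight lam s / quad x t s ^ (lam + 1)) :=
    Measurable.stronglyMeasurable (by unfold Function.uncurry weight quad; fun_prop)
  exact this.integral_prod_right.measurable

/-- On opposite signs the kernel is only mildly singular. -/
theorem kernelIntegral_le_of_neg {lam θ : ℝ} (hl : 0 < lam) (hθ0 : 0 < θ) (hθ1 : θ < 1) {x t : ℝ}
    (hx : x ≤ 0) (ht : 0 < t) (h : |x| ≠ |t|) :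
    kernelIntegral lam x t ≤ ((x ^ 2 + t ^ 2) / 2) ^ (-(lam + θ)) * ((|x| - |t|) ^ 2) ^ (-(1 - θ)) *
      ∫ s in (-1 : ℝ)..1, (1 + s) ^ (-θ) * (1 - s) ^ (lam - 1) := by
  rw [← intervalIntegral.integral_const_mul]
  refine integral_le_of_le (intervalIntegrable_div_quad lam h (intervalIntegrable_weight hl))
    ((intervalIntegrable_jacobi (by linarith) (by linarith)).const_mul _) fun s h1 h2 => ?_
  have hq := quad_pos h1.le h2.le h
  have a : 0 < 1 + s := by linarith
  have b : 0 < 1 - s := by linarith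
  have m : 0 < (x ^ 2 + t ^ 2) / 2 := by positivity
  have hD : 0 < (|x| - |t|) ^ 2 := by have := sub_ne_zero.2 h; positivity
  -- The exponent λ + 1 is split as (λ + θ) + (1 - θ). The first part uses up the weight (1 + s)^λ
  -- and leaves (1 + s)^(-θ), integrable since θ < 1; the second leaves ||x| - |t||^(-2(1-θ)).
  have e1 : ((1 + s) * ((x ^ 2 + t ^ 2) / 2)) ^ (lam + θ) ≤ quad x t s ^ (lam + θ) :=
    Real.rpow_le_rpow (by positivity)
      (quad_ge_of_nonpos (mul_nonpos_of_nonpos_of_nonneg hx ht.le) h1.le h2.le) (by linarith)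
  have e2 : ((|x| - |t|) ^ 2) ^ (1 - θ) ≤ quad x t s ^ (1 - θ) :=
    Real.rpow_le_rpow hD.le (sq_le_quad x t h1.le h2.le) (by linarith)
  rw [Real.mul_rpow a.le m.le] at e1
  have e3 : quad x t s ^ (lam + 1) = quad x t s ^ (lam + θ) * quad x t s ^ (1 - θ) := by
    rw [← Real.rpow_add hq]
    congr 1
    ring
  have e4 := mul_le_mul e1 e2 (by positivity) (by positivity)
  rw [weight_eq lam h1 h2, e3]
  calc _ ≤ (1 + s) ^ lam * (1 - s) ^ (lam - 1) / ((1 + s) ^ (lam + θ) *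
        ((x ^ 2 + t ^ 2) / 2) ^ (lam + θ) * ((|x| - |t|) ^ 2) ^ (1 - θ)) :=
        div_le_div_of_nonneg_left (by positivity) (by positivity) e4
    _ = _ := by
      rw [Real.rpow_neg m.le, Real.rpow_neg hD.le, Real.rpow_neg a.le, Real.rpow_add a]
      have := (Real.rpow_pos_of_pos a lam).ne'
      have := (Real.rpow_pos_of_pos a θ).ne'
      have := (Real.rpow_pos_of_pos m (lam + θ)).ne'
      have := (Real.rpow_pos_of_pos hD (1 - θ)).ne'
      field_simp

/-- The leading part of the kernel on equal signs, in closed form. -/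
theorem integral_leading {lam : ℝ} (hl : 0 < lam) {x t : ℝ} (hx : 0 ≤ x) (ht : 0 < t)
    (h : x ≠ t) :
    ∫ s in (-1 : ℝ)..1, (1 - s) ^ (lam - 1) / quad x t s ^ (lam + 1) =
      (lam * (x - t) ^ 2)⁻¹ * (2 / (x + t) ^ 2) ^ lam := by
  have h' : |x| ≠ |t| := by rwa [abs_of_nonneg hx, abs_of_pos ht]
  have hu : x - t ≠ 0 := sub_ne_zero.2 h
  have hint : IntervalIntegrable (fun s : ℝ => (1 - s) ^ (lam - 1)) volume (-1) 1 := by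
    have := (intervalIntegral.intervalIntegrable_rpow' (a := 2) (b := 0)
      (by linarith : -1 < lam - 1)).comp_sub_left 1
    norm_num at this
    exact this
  -- The derivative of (1 - s)/quad is -(x - t)²/quad², which yields this primitive. It vanishes at
  -- s = 1 because λ > 0, and quad = (x + t)² at s = -1.
  have hF : ∀ s ∈ Set.Ioo (-1 : ℝ) 1, HasDerivAt
      (fun s => -((lam * (x - t) ^ 2)⁻¹ * ((1 - s) / quad x t s) ^ lam))
      ((1 - s) ^ (lam - 1) / quad x t s ^ (lam + 1)) s := fun s hs => by
    have hq := quad_pos hs.1.le hs.2.le h'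
    have b : 0 < 1 - s := by linarith [hs.2]
    have d1 : HasDerivAt (fun s : ℝ => 1 - s) (-1) s := by
      simpa using (hasDerivAt_id s).const_sub 1
    have d2 : HasDerivAt (fun s : ℝ => quad x t s) (-(2 * x * t)) s := by
      simpa [quad] using ((hasDerivAt_id s).const_mul (2 * x * t)).const_sub (x ^ 2 + t ^ 2)
    have d3 := (((d1.div d2 hq.ne').rpow_const (p := lam)
      (Or.inl (div_pos b hq).ne')).const_mul ((lam * (x - t) ^ 2)⁻¹)).neg
    refine d3.congr_deriv ?_
    simp only [Pi.div_apply]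
    rw [Real.div_rpow b.le hq.le, Real.rpow_sub hq, Real.rpow_add hq, Real.rpow_one]
    have e : -1 * quad x t s - (1 - s) * -(2 * x * t) = -(x - t) ^ 2 := by unfold quad; ring
    rw [e]
    have := (Real.rpow_pos_of_pos hq lam).ne'
    field_simp
  rw [intervalIntegral.integral_eq_sub_of_hasDerivAt_of_le (by norm_num) ?_ hF
    (intervalIntegrable_div_quad lam h' hint)]
  · have e : quad x t (-1) = (x + t) ^ 2 := by unfold quad; ring
    rw [e, sub_self, zero_div, Real.zero_rpow hl.ne']
    norm_num
  · intro s hs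
    have hq := quad_pos hs.1 hs.2 h'
    refine ContinuousAt.continuousWithinAt ?_
    have c1 : ContinuousAt (fun s => (1 - s) / quad x t s) s := by
      refine ContinuousAt.div (by fun_prop) ?_ hq.ne'
      unfold quad
      fun_prop
    exact ((c1.rpow_const (Or.inr hl.le)).const_mul _).neg

/-- Used with v = 1 - s, to replace (1 + s)^λ by 2^λ at a cost linear in 1 - s. Bernoulli's
inequality serves for λ ≥ 1, comparison with the first power for λ ≤ 1. -/
theorem two_rpow_sub_le {lam : ℝ} (hl : 0 < lam) {v : ℝ} (h0 : 0 ≤ v) (h2 : v ≤ 2) :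
    2 ^ lam - (2 - v) ^ lam ≤ 2 ^ lam * (1 + lam) * v := by
  have e : (2 - v) ^ lam = 2 ^ lam * (1 + -(v / 2)) ^ lam := by
    rw [← Real.mul_rpow (by norm_num) (by linarith)]
    congr 1
    ring
  have p : 0 < (2 : ℝ) ^ lam := by positivity
  have key : 1 - (1 + lam) * v ≤ (1 + -(v / 2)) ^ lam := by
    rcases le_total 1 lam with h | h
    · have := one_add_mul_self_le_rpow_one_add (s := -(v / 2)) (by linarith) h
      nlinarith
    · have : (1 + -(v / 2)) ^ (1 : ℝ) ≤ (1 + -(v / 2)) ^ lam := by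
        rcases eq_or_lt_of_le (show 0 ≤ 1 + -(v / 2) by linarith) with h3 | h3
        · rw [← h3, Real.zero_rpow hl.ne', Real.zero_rpow one_ne_zero]
        · exact Real.rpow_le_rpow_of_exponent_ge h3 (by linarith) h
      rw [Real.rpow_one] at this
      nlinarith
  rw [e]
  nlinarith

/-- On equal signs, the kernel is its leading part up to an error of lower order. -/
theorem kernelIntegral_of_nonneg {lam : ℝ} (hl : 0 < lam) {x t : ℝ} (hx : 0 ≤ x) (ht : 0 < t)
    (h : x ≠ t) : ∃ R, kernelIntegral lam x t =
      2 ^ lam * ((lam * (x - t) ^ 2)⁻¹ * (2 / (x + t) ^ 2) ^ lam) - R ∧ 0 ≤ R ∧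
      R ≤ 2 ^ lam * (1 + lam) * ((x ^ 2 + t ^ 2) / 2) ^ (-(lam + 1 / 2)) * |x - t|⁻¹ *
        ∫ s in (-1 : ℝ)..1, (1 - s) ^ (-(1 / 2) : ℝ) := by
  have h' : |x| ≠ |t| := by rwa [abs_of_nonneg hx, abs_of_pos ht]
  have hint : ∀ a : ℝ, -1 < a →
      IntervalIntegrable (fun s : ℝ => (1 - s) ^ a) volume (-1) 1 := fun a ha => by
    have := (intervalIntegral.intervalIntegrable_rpow' (a := 2) (b := 0) ha).comp_sub_left 1
    norm_num at this
    exact this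
  have i1 := (intervalIntegrable_div_quad lam h' (hint (lam - 1) (by linarith))).const_mul (2 ^ lam)
  have i2 := intervalIntegrable_div_quad lam h' (intervalIntegrable_weight hl)
  -- R collects the replacement of (1 + s)^λ by 2^λ, which gains a factor 1 - s. Splitting λ + 1 as
  -- (λ + 1/2) + 1/2 then leaves (1 - s)^(-1/2) |x - t|⁻¹.
  refine ⟨∫ s in (-1 : ℝ)..1, (2 ^ lam * ((1 - s) ^ (lam - 1) / quad x t s ^ (lam + 1)) -
    weight lam s / quad x t s ^ (lam + 1)), ?_, ?_, ?_⟩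
  · rw [← integral_leading hl hx ht h, intervalIntegral.integral_sub i1 i2,
      intervalIntegral.integral_const_mul, sub_sub_cancel]
    rfl
  · rw [show (0 : ℝ) = ∫ s in (-1 : ℝ)..1, (0 : ℝ) by simp]
    refine integral_le_of_le (by simp) (i1.sub i2) fun s h1 h2 => ?_
    have hq := Real.rpow_pos_of_pos (quad_pos h1.le h2.le h') (lam + 1)
    have b : 0 < 1 - s := by linarith
    rw [weight_eq lam h1 h2, ← mul_div_assoc, ← sub_div, ← sub_mul]
    refine div_nonneg (mul_nonneg (sub_nonneg.2 ?_) (Real.rpow_nonneg b.le _)) hq.le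
    exact Real.rpow_le_rpow (by linarith) (by linarith) hl.le
  · rw [← intervalIntegral.integral_const_mul]
    refine integral_le_of_le (i1.sub i2) ((hint _ (by norm_num)).const_mul _) fun s h1 h2 => ?_
    have hq := quad_pos h1.le h2.le h'
    have b : 0 < 1 - s := by linarith
    have m : 0 < (x ^ 2 + t ^ 2) / 2 := by positivity
    have hu : 0 < |x - t| := abs_pos.2 (sub_ne_zero.2 h)
    have e0 : 2 ^ lam - (1 + s) ^ lam ≤ 2 ^ lam * (1 + lam) * (1 - s) := by
      have := two_rpow_sub_le hl (v := 1 - s) b.le (by linarith)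
      rwa [show 2 - (1 - s) = 1 + s by ring] at this
    have e1 : ((1 - s) * ((x ^ 2 + t ^ 2) / 2)) ^ (lam + 1 / 2) ≤ quad x t s ^ (lam + 1 / 2) :=
      Real.rpow_le_rpow (by positivity)
        (quad_ge_of_nonneg (mul_nonneg hx ht.le) h1.le h2.le) (by linarith)
    have e2 : |x - t| ≤ quad x t s ^ (1 / 2 : ℝ) := by
      rw [← Real.sqrt_eq_rpow]
      refine Real.abs_le_sqrt ?_
      have := sq_le_quad x t h1.le h2.le
      rwa [abs_of_nonneg hx, abs_of_pos ht] at this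
    rw [Real.mul_rpow b.le m.le] at e1
    have e3 : quad x t s ^ (lam + 1) = quad x t s ^ (lam + 1 / 2) * quad x t s ^ (1 / 2 : ℝ) := by
      rw [← Real.rpow_add hq]
      congr 1
      ring
    have e4 := mul_le_mul e1 e2 (by positivity) (by positivity)
    rw [weight_eq lam h1 h2, ← mul_div_assoc, ← sub_div, ← sub_mul, e3]
    calc _ ≤ 2 ^ lam * (1 + lam) * (1 - s) * (1 - s) ^ (lam - 1) /
          ((1 - s) ^ (lam + 1 / 2) * ((x ^ 2 + t ^ 2) / 2) ^ (lam + 1 / 2) * |x - t|) :=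
          div_le_div₀ (by positivity) (mul_le_mul_of_nonneg_right e0 (by positivity))
            (by positivity) e4
      _ = _ := by
        rw [Real.rpow_neg m.le, Real.rpow_neg b.le, Real.rpow_add b, Real.rpow_sub b, Real.rpow_one]
        have := (Real.rpow_pos_of_pos b lam).ne'
        have := (Real.rpow_pos_of_pos b (1 / 2)).ne'
        have := (Real.rpow_pos_of_pos m (lam + 1 / 2)).ne'
        field_simp

/-- For x ≥ 0 the leading part alone is an upper bound, since R ≥ 0. For x ≤ 0 the choice θ = 1/2
gives ||x| - 1|⁻¹, and |x - 1| = 1 + |x| absorbs the spare decay. -/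
theorem kernelIntegral_size {lam : ℝ} (hl : 0 < lam) : ∃ C : ℝ, 0 < C ∧ ∀ x : ℝ, |x| ≠ 1 →
    |x - 1| * kernelIntegral lam x 1 ≤ C * (1 + |x|) ^ (-(2 * lam)) * |(|x| - 1)|⁻¹ := by
  set K : ℝ := ∫ s in (-1 : ℝ)..1, (1 + s) ^ (-(1 / 2) : ℝ) * (1 - s) ^ (lam - 1) with hK
  have hK0 : 0 ≤ K := intervalIntegral.integral_nonneg (by norm_num) fun s hs =>
    mul_nonneg (Real.rpow_nonneg (by linarith [hs.1]) _) (Real.rpow_nonneg (by linarith [hs.2]) _)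
  refine ⟨4 ^ lam * lam⁻¹ + 4 ^ (lam + 1 / 2) * K, by positivity, fun x hx => ?_⟩
  have hx1 : |x| - 1 ≠ 0 := sub_ne_zero.2 hx
  have hD : 0 < |(|x| - 1)| := abs_pos.2 hx1
  have hp : 0 < 1 + |x| := by positivity
  rcases le_total 0 x with h | h
  · rw [abs_of_nonneg h] at hx hx1 hD hp ⊢
    obtain ⟨R, h1, h2, -⟩ := kernelIntegral_of_nonneg hl h one_pos hx
    have e : 2 ^ lam * ((lam * (x - 1) ^ 2)⁻¹ * (2 / (x + 1) ^ 2) ^ lam) =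
        4 ^ lam * lam⁻¹ * (1 + x) ^ (-(2 * lam)) * (|x - 1|⁻¹) ^ 2 := by
      rw [Real.div_rpow (by norm_num) (by positivity), ← Real.rpow_natCast (x + 1) 2,
        ← Real.rpow_mul (by linarith), Real.rpow_neg hp.le, inv_pow, sq_abs, add_comm x 1,
        show (4 : ℝ) = 2 * 2 by norm_num, Real.mul_rpow (by norm_num) (by norm_num)]
      push_cast
      have := (Real.rpow_pos_of_pos hp (2 * lam)).ne'
      field_simp
    calc |x - 1| * kernelIntegral lam x 1
        ≤ |x - 1| * (4 ^ lam * lam⁻¹ * (1 + x) ^ (-(2 * lam)) * (|x - 1|⁻¹) ^ 2) :=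
          mul_le_mul_of_nonneg_left (by rw [h1, e]; linarith) hD.le
      _ = 4 ^ lam * lam⁻¹ * (1 + x) ^ (-(2 * lam)) * |x - 1|⁻¹ := by
          field_simp
      _ ≤ _ := by
          have : 0 ≤ 4 ^ (lam + 1 / 2) * K := by positivity
          have hq : 0 ≤ (1 + x) ^ (-(2 * lam)) := Real.rpow_nonneg hp.le _
          have hr : 0 ≤ |x - 1|⁻¹ := by positivity
          gcongr
          linarith
  · have hJ := kernelIntegral_le_of_neg hl (θ := 1 / 2) (by norm_num) (by norm_num) h one_pos
      (by simpa using hx)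
    rw [← hK] at hJ
    have e1 : ((|x| - |(1:ℝ)|) ^ 2) ^ (-(1 - 1 / 2) : ℝ) = |(|x| - 1)|⁻¹ := by
      rw [abs_one, ← sq_abs, ← Real.rpow_natCast, ← Real.rpow_mul hD.le]
      norm_num
      exact Real.rpow_neg_one _
    have e2 : ((x ^ 2 + 1 ^ 2) / 2) ^ (-(lam + 1 / 2)) ≤
        4 ^ (lam + 1 / 2) * (1 + |x|) ^ (-(2 * lam)) * (1 + |x|)⁻¹ := by
      have : (1 + |x|) ^ 2 / 4 ≤ (x ^ 2 + 1 ^ 2) / 2 := by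
        nlinarith [sq_abs x, sq_nonneg (|x| - 1)]
      refine (Real.rpow_le_rpow_of_nonpos (by positivity) this (by linarith)).trans (le_of_eq ?_)
      rw [Real.div_rpow (by positivity) (by norm_num), Real.rpow_neg (by norm_num : (0:ℝ) ≤ 4),
        ← Real.rpow_natCast, ← Real.rpow_mul hp.le, div_inv_eq_mul, mul_comm, mul_assoc,
        ← Real.rpow_neg_one (1 + |x|), ← Real.rpow_add hp]
      congr 2
      push_cast
      ring
    have e3 : |x - 1| = 1 + |x| := by
      rw [abs_of_nonpos (by linarith), abs_of_nonpos h]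
      ring
    rw [e1] at hJ
    rw [e3]
    have hq : 0 < (1 + |x|) ^ (-(2 * lam)) := Real.rpow_pos_of_pos hp _
    calc (1 + |x|) * kernelIntegral lam x 1
        ≤ (1 + |x|) * (4 ^ (lam + 1 / 2) * (1 + |x|) ^ (-(2 * lam)) * (1 + |x|)⁻¹ *
            |(|x| - 1)|⁻¹ * K) := by
          refine mul_le_mul_of_nonneg_left (hJ.trans ?_) hp.le
          gcongr
      _ = 4 ^ (lam + 1 / 2) * K * (1 + |x|) ^ (-(2 * lam)) * |(|x| - 1)|⁻¹ := by
          field_simp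
      _ ≤ _ := by
          have : 0 ≤ 4 ^ lam * lam⁻¹ := by positivity
          gcongr
          linarith

/-- Mean value inequality. The interval contains every 2t/(x + t) with 0 ≤ x ≤ 5 and 1/2 < t < 3/2.
-/
theorem exists_rpow_sub_one_le (a : ℝ) : ∃ C : ℝ, 0 ≤ C ∧ ∀ y ∈ Set.Icc (1 / 10 : ℝ) 2,
    |y ^ a - 1| ≤ C * |y - 1| := by
  have hcont : ContinuousOn (fun y : ℝ => a * y ^ (a - 1)) (Set.Icc (1 / 10 : ℝ) 2) := by
    intro y hy
    have : y ≠ 0 := by linarith [hy.1]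
    exact ((continuousAt_id.rpow_const (Or.inl this)).const_mul a).continuousWithinAt
  obtain ⟨C, hC⟩ := isCompact_Icc.exists_bound_of_continuousOn hcont
  refine ⟨C, (norm_nonneg _).trans (hC 1 ⟨by norm_num, by norm_num⟩), fun y hy => ?_⟩
  have := (convex_Icc (1 / 10 : ℝ) 2).norm_image_sub_le_of_norm_hasDerivWithin_le
    (f := fun y : ℝ => y ^ a) (fun z hz => (Real.hasDerivAt_rpow_const (p := a)
      (Or.inl (by linarith [hz.1] : z ≠ 0))).hasDerivWithinAt) hC
    (show (1 : ℝ) ∈ Set.Icc (1 / 10 : ℝ) 2 from ⟨by norm_num, by norm_num⟩) hy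
  simpa using this

/-! ### The kernel near the diagonal and near its reflection -/

/-- Near the diagonal the kernel is the classical Hilbert kernel up to a bounded error. -/
theorem kernel_error_bound {lam : ℝ} (hl : 0 < lam) : ∃ C : ℝ, 0 ≤ C ∧ ∀ x t : ℝ, 0 ≤ x → x ≤ 5 →
    1 / 2 < t → t < 3 / 2 → x ≠ t →
    |t ^ (2 * lam) * ((x - t) * kernelIntegral lam x t) - lam⁻¹ * (1 / (x - t))| ≤ C := by
  obtain ⟨C₁, hC₁, hlip⟩ := exists_rpow_sub_one_le (2 * lam)
  set K : ℝ := ∫ s in (-1 : ℝ)..1, (1 - s) ^ (-(1 / 2) : ℝ) with hK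
  have hK0 : 0 ≤ K := intervalIntegral.integral_nonneg (by norm_num) fun s hs =>
    Real.rpow_nonneg (by linarith [hs.2]) _
  set B : ℝ := 2 ^ lam * (1 + lam) * (1 / 8) ^ (-(lam + 1 / 2)) * K with hB
  refine ⟨lam⁻¹ * (C₁ * 2) + (3 / 2) ^ (2 * lam) * B, by positivity, fun x t h0 h5 ht1 ht2 h => ?_⟩
  have ht : 0 < t := by linarith
  have hu : x - t ≠ 0 := sub_ne_zero.2 h
  have hu' : 0 < |x - t| := abs_pos.2 hu
  have hs : 0 < x + t := by linarith
  obtain ⟨R, h1, h2, h3⟩ := kernelIntegral_of_nonneg hl h0 ht h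
  have hR : |x - t| * R ≤ B := by
    have : ((x ^ 2 + t ^ 2) / 2) ^ (-(lam + 1 / 2)) ≤ (1 / 8 : ℝ) ^ (-(lam + 1 / 2)) :=
      Real.rpow_le_rpow_of_nonpos (by norm_num) (by nlinarith [sq_nonneg x]) (by linarith)
    calc |x - t| * R ≤ |x - t| * (2 ^ lam * (1 + lam) * ((x ^ 2 + t ^ 2) / 2) ^ (-(lam + 1 / 2)) *
          |x - t|⁻¹ * K) := mul_le_mul_of_nonneg_left h3 hu'.le
      _ = 2 ^ lam * (1 + lam) * ((x ^ 2 + t ^ 2) / 2) ^ (-(lam + 1 / 2)) * K := by field_simp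
      _ ≤ B := by rw [hB]; gcongr
  have e1 : t ^ (2 * lam) * (2 ^ lam * (2 / (x + t) ^ 2) ^ lam) = (2 * t / (x + t)) ^ (2 * lam) := by
    have e : (2 * t / (x + t)) ^ (2 * lam) = ((2 * t / (x + t)) ^ 2) ^ lam := by
      rw [← Real.rpow_natCast, ← Real.rpow_mul (by positivity)]
      norm_num
    have e' : t ^ (2 * lam) = (t ^ 2) ^ lam := by
      rw [← Real.rpow_natCast, ← Real.rpow_mul (by positivity)]
      norm_num
    rw [e, e', ← Real.mul_rpow (by norm_num) (by positivity),
      ← Real.mul_rpow (by positivity) (by positivity)]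
    congr 1
    field_simp
  -- The leading part is λ⁻¹ (2t/(x + t))^(2λ)/(x - t). The ratio 2t/(x + t) differs from 1 by O(|x
  -- - t|), so replacing the power by 1 costs a bounded term.
  have e2 : t ^ (2 * lam) * ((x - t) * kernelIntegral lam x t) - lam⁻¹ * (1 / (x - t)) =
      lam⁻¹ * (((2 * t / (x + t)) ^ (2 * lam) - 1) / (x - t)) - t ^ (2 * lam) * ((x - t) * R) := by
    rw [h1, ← e1]
    field_simp
    ring
  have hy : 2 * t / (x + t) ∈ Set.Icc (1 / 10 : ℝ) 2 := by
    constructor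
    · rw [le_div_iff₀ hs]; linarith
    · rw [div_le_iff₀ hs]; linarith
  have h4 : |((2 * t / (x + t)) ^ (2 * lam) - 1) / (x - t)| ≤ C₁ * 2 := by
    rw [abs_div, div_le_iff₀ hu']
    refine (hlip _ hy).trans ?_
    rw [mul_assoc]
    refine mul_le_mul_of_nonneg_left ?_ hC₁
    rw [show 2 * t / (x + t) - 1 = -(x - t) / (x + t) by field_simp; ring, abs_div, abs_neg,
      abs_of_pos hs, div_le_iff₀ hs]
    nlinarith
  have h5 : t ^ (2 * lam) ≤ (3 / 2 : ℝ) ^ (2 * lam) :=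
    Real.rpow_le_rpow ht.le ht2.le (by linarith)
  rw [e2]
  refine (abs_sub _ _).trans (add_le_add ?_ ?_)
  · rw [abs_mul, abs_of_pos (inv_pos.2 hl)]
    gcongr
  · rw [abs_mul, abs_mul, abs_of_nonneg h2, abs_of_nonneg (Real.rpow_nonneg ht.le _)]
    gcongr

/-- Near the reflected diagonal the kernel is bounded by an integrable singularity. -/
theorem kernel_reflected_bound {lam : ℝ} (hl : 0 < lam) : ∃ C : ℝ, 0 ≤ C ∧ ∀ x t : ℝ, x ≤ 0 →
    -5 ≤ x → 1 / 2 < t → t < 3 / 2 → |x| ≠ t →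
    |t ^ (2 * lam) * ((x - t) * kernelIntegral lam x t)| ≤ C * |(|x| - t)| ^ (-(1 / 2) : ℝ) := by
  set K : ℝ := ∫ s in (-1 : ℝ)..1, (1 + s) ^ (-(3 / 4) : ℝ) * (1 - s) ^ (lam - 1) with hK
  have hK0 : 0 ≤ K := intervalIntegral.integral_nonneg (by norm_num) fun s hs =>
    mul_nonneg (Real.rpow_nonneg (by linarith [hs.1]) _) (Real.rpow_nonneg (by linarith [hs.2]) _)
  refine ⟨(3 / 2) ^ (2 * lam) * (7 * ((1 / 8) ^ (-(lam + 3 / 4)) * K)), by positivity,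
    fun x t h0 h5 ht1 ht2 h => ?_⟩
  have ht : 0 < t := by linarith
  have hD : 0 < |(|x| - t)| := abs_pos.2 (sub_ne_zero.2 h)
  -- With θ = 3/4 the remaining singularity has exponent 2(1 - θ) = 1/2, integrable in t.
  have hJ := kernelIntegral_le_of_neg hl (θ := 3 / 4) (by norm_num) (by norm_num) h0 ht
    (by rwa [abs_of_pos ht])
  rw [← hK, abs_of_pos ht] at hJ
  have e1 : ((|x| - t) ^ 2) ^ (-(1 - 3 / 4) : ℝ) = |(|x| - t)| ^ (-(1 / 2) : ℝ) := by
    rw [← sq_abs, ← Real.rpow_natCast, ← Real.rpow_mul hD.le]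
    norm_num
  have e2 : ((x ^ 2 + t ^ 2) / 2) ^ (-(lam + 3 / 4)) ≤ (1 / 8 : ℝ) ^ (-(lam + 3 / 4)) :=
    Real.rpow_le_rpow_of_nonpos (by norm_num) (by nlinarith [sq_nonneg x]) (by linarith)
  rw [e1] at hJ
  have h6 : t ^ (2 * lam) ≤ (3 / 2 : ℝ) ^ (2 * lam) :=
    Real.rpow_le_rpow ht.le ht2.le (by linarith)
  have h7 : |x - t| ≤ 7 := by rw [abs_le]; constructor <;> linarith
  have hq : 0 < |(|x| - t)| ^ (-(1 / 2) : ℝ) := Real.rpow_pos_of_pos hD _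
  rw [abs_mul, abs_mul, abs_of_nonneg (kernelIntegral_nonneg _ _ _),
    abs_of_nonneg (Real.rpow_nonneg ht.le _)]
  calc _ ≤ (3 / 2 : ℝ) ^ (2 * lam) * (7 * ((1 / 8) ^ (-(lam + 3 / 4)) *
        |(|x| - t)| ^ (-(1 / 2) : ℝ) * K)) := by
        have hJ' := hJ.trans (show _ ≤ (1 / 8 : ℝ) ^ (-(lam + 3 / 4)) *
          |(|x| - t)| ^ (-(1 / 2) : ℝ) * K by gcongr)
        have := kernelIntegral_nonneg lam x t
        gcongr
    _ = _ := by ring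

/-! ### Cancellation away from the support -/

/-- Taylor's theorem for bounded holomorphic functions on a disc, with remainder bound. -/
theorem exists_taylor {f : ℂ → ℂ} {c : ℂ} {R B : ℝ} (hR : 0 < R)
    (hd : DifferentiableOn ℂ f (Metric.ball c R)) (hB : ∀ z ∈ Metric.ball c R, ‖f z‖ ≤ B) (k : ℕ) :
    ∃ (Q : Polynomial ℂ) (g : ℂ → ℂ), Q.degree < k ∧ DifferentiableOn ℂ g (Metric.ball c R) ∧
      (∀ z ∈ Metric.ball c R, ‖g z‖ ≤ B * (2 / R) ^ k) ∧
      ∀ z ∈ Metric.ball c R, f z = Q.eval z + (z - c) ^ k * g z := by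
  have hc : c ∈ Metric.ball c R := Metric.mem_ball_self hR
  induction k with
  | zero => exact ⟨0, f, by simp, hd, by simpa using hB, by simp⟩
  | succ k ih =>
    obtain ⟨Q, g, h1, h2, h3, h4⟩ := ih
    -- Each step moves the value at the centre into the polynomial. The Schwarz lemma applied to g -
    -- g(c), of size at most twice the bound for g, costs a factor 2/R.
    refine ⟨Q + g c • (Polynomial.X - Polynomial.C c) ^ k, dslope g c, ?_, ?_, ?_, ?_⟩
    · refine (Polynomial.degree_add_le _ _).trans_lt (max_lt (h1.trans ?_) ?_)
      · exact_mod_cast Nat.lt_succ_self k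
      · refine (Polynomial.degree_smul_le _ _).trans_lt ?_
        rw [Polynomial.degree_pow, Polynomial.degree_X_sub_C, nsmul_one]
        exact_mod_cast Nat.lt_succ_self k
    · exact (Complex.differentiableOn_dslope (Metric.isOpen_ball.mem_nhds hc)).2 h2
    · intro z hz
      have := Complex.norm_dslope_le_div_of_mapsTo_ball (R₂ := 2 * (B * (2 / R) ^ k)) h2
        (fun w hw => by
          rw [Metric.mem_closedBall, dist_eq_norm]
          refine (norm_sub_le _ _).trans ?_
          linarith [h3 w hw, h3 c hc]) hz
      refine this.trans (le_of_eq ?_)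
      rw [pow_succ]
      ring
    · intro z hz
      have := sub_smul_dslope g c z
      rw [smul_eq_mul] at this
      rw [h4 z hz]
      simp only [Polynomial.eval_add, Polynomial.eval_smul, smul_eq_mul, Polynomial.eval_C, Polynomial.eval_pow,
        Polynomial.eval_sub, Polynomial.eval_X]
      rw [pow_succ]
      linear_combination -(z - c) ^ k * this

/-- The quadratic form stays comparable to its value at `1` on a complex disc around `1`. -/
theorem norm_quad_sub_le {x s : ℝ} (h1 : -1 ≤ s) (h2 : s ≤ 1) {z : ℂ}
    (hz : ‖z - 1‖ ≤ |(|x| - 1)| / 4) :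
    ‖(x : ℂ) ^ 2 + z ^ 2 - 2 * x * z * s - (quad x 1 s : ℂ)‖ ≤ 9 / 16 * quad x 1 s := by
  have hq : (|x| - 1) ^ 2 ≤ quad x 1 s := by simpa using sq_le_quad x 1 h1 h2
  have hq0 : 0 ≤ quad x 1 s := (sq_nonneg _).trans hq
  -- Both |1 - xs| and ||x| - 1| are at most √quad, so the increment is at most (1/16 + 2/4) quad =
  -- (9/16) quad.
  have e1 : (x : ℂ) ^ 2 + z ^ 2 - 2 * x * z * s - (quad x 1 s : ℂ) =
      (z - 1) ^ 2 + 2 * (z - 1) * ((1 - x * s : ℝ) : ℂ) := by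
    unfold quad
    push_cast
    ring
  have e2 : |1 - x * s| ≤ √(quad x 1 s) := by
    refine Real.abs_le_sqrt ?_
    unfold quad
    nlinarith [mul_nonneg (sq_nonneg x) (show (0:ℝ) ≤ 1 - s ^ 2 by nlinarith)]
  have e3 : |(|x| - 1)| ≤ √(quad x 1 s) := Real.abs_le_sqrt hq
  have e4 : ‖z - 1‖ ≤ √(quad x 1 s) / 4 := hz.trans (by linarith)
  have e5 := Real.sq_sqrt hq0
  rw [e1]
  refine (norm_add_le _ _).trans ?_
  rw [norm_pow, norm_mul, norm_mul, Complex.norm_real, Complex.norm_ofNat, Real.norm_eq_abs]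
  have e6 : ‖z - 1‖ ^ 2 ≤ (√(quad x 1 s) / 4) ^ 2 := pow_le_pow_left₀ (norm_nonneg _) e4 2
  have e7 : ‖z - 1‖ * |1 - x * s| ≤ √(quad x 1 s) / 4 * √(quad x 1 s) :=
    mul_le_mul e4 e2 (abs_nonneg _) (by positivity)
  nlinarith

section

variable {b : ℝ → ℂ} {δ : ℝ}

theorem integrable_mul_of_bound {α β : ℝ} (hm : Measurable b) (hb : ∀ t, ‖b t‖ ≤ 1) (hαβ : α ≤ β)
    (hs : ∀ t, t ∉ Set.Ioo α β → b t = 0) {F : ℝ → ℂ}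
    (hF : Measurable F) {M : ℝ} (hM : ∀ t ∈ Set.Ioo α β, ‖F t‖ ≤ M) :
    Integrable (fun t => b t * F t) ∧ ‖∫ t, b t * F t‖ ≤ M * (β - α) := by
  have hi := integrable_of_bounded_support hm.aestronglyMeasurable hb hs
  have hp : ∀ t, ‖b t * F t‖ ≤ ‖b t‖ * M := fun t => by
    rw [norm_mul]
    by_cases h : t ∈ Set.Ioo α β
    · exact mul_le_mul_of_nonneg_left (hM t h) (norm_nonneg _)
    · rw [hs t h, norm_zero, zero_mul, zero_mul]
  refine ⟨(hi.norm.mul_const M).mono' (hm.mul hF).aestronglyMeasurable (ae_of_all _ hp), ?_⟩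
  rcases eq_or_lt_of_le hαβ with h | h
  · have : ∀ t, b t = 0 := fun t => hs t (by simp [h])
    simp [this, h]
  · have hM0 : 0 ≤ M := (norm_nonneg _).trans
      (hM ((α + β) / 2) ⟨by linarith, by linarith⟩)
    calc ‖∫ t, b t * F t‖ ≤ ∫ t, ‖b t‖ * M :=
          norm_integral_le_of_norm_le (hi.norm.mul_const M) (ae_of_all _ hp)
      _ = M * ∫ t, ‖b t‖ := by rw [integral_mul_const, mul_comm]
      _ ≤ M * (β - α) :=
          mul_le_mul_of_nonneg_left (integral_norm_le_of_bounded_support hb hαβ hs) hM0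

theorem integral_mul_polynomial_eq_zero {lam : ℝ} (hl : 0 < lam) (hδ0 : 0 < δ) (hδ : δ < 1 / 2)
    (hm : Measurable b) (hb : ∀ t, ‖b t‖ ≤ 1)
    (hs : ∀ t, t ∉ Set.Ioo (1 - δ) (1 + δ) → b t = 0) {k : ℕ}
    (hmom : ∀ j < k, ∫ t : ℝ, (t : ℂ) ^ j * b t * ((|t| ^ (2 * lam) : ℝ) : ℂ) = 0)
    {Q : Polynomial ℂ} (hQ : Q.degree < k) :
    Integrable (fun t : ℝ => b t * (Q.eval (t : ℂ) * ((|t| ^ (2 * lam) : ℝ) : ℂ))) ∧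
      ∫ t : ℝ, b t * (Q.eval (t : ℂ) * ((|t| ^ (2 * lam) : ℝ) : ℂ)) = 0 := by
  have hi : ∀ j : ℕ, Integrable fun t : ℝ => (t : ℂ) ^ j * b t * ((|t| ^ (2 * lam) : ℝ) : ℂ) :=
    fun j => by
      have := (integrable_mul_of_bound hm hb (by linarith) hs
        (F := fun t : ℝ => (t : ℂ) ^ j * ((|t| ^ (2 * lam) : ℝ) : ℂ)) (by fun_prop)
        (M := 2 ^ j * 2 ^ (2 * lam)) fun t ht => ?_).1
      · refine this.congr (ae_of_all _ fun t => ?_)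
        simp only
        ring
      · have h2 : |t| ≤ 2 := by rw [abs_le]; constructor <;> linarith [ht.1, ht.2]
        rw [norm_mul, norm_pow, Complex.norm_real, Complex.norm_real, Real.norm_eq_abs,
          Real.norm_of_nonneg (by positivity)]
        gcongr
  have hdeg : Q = 0 ∨ Q.natDegree < k := by
    by_cases h : Q = 0
    · exact Or.inl h
    · exact Or.inr ((Polynomial.natDegree_lt_iff_degree_lt h).2 hQ)
  rcases hdeg with h | h
  · simp [h]
  have e : ∀ t : ℝ, b t * (Q.eval (t : ℂ) * ((|t| ^ (2 * lam) : ℝ) : ℂ)) =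
      ∑ j ∈ Finset.range k, Q.coeff j * ((t : ℂ) ^ j * b t * ((|t| ^ (2 * lam) : ℝ) : ℂ)) :=
    fun t => by
      rw [Polynomial.eval_eq_sum_range' h, Finset.sum_mul, Finset.mul_sum]
      exact Finset.sum_congr rfl fun j _ => by ring
  simp only [e]
  refine ⟨integrable_finsetSum _ fun j _ => (hi j).const_mul _, ?_⟩
  rw [integral_finsetSum _ fun j _ => (hi j).const_mul _]
  refine Finset.sum_eq_zero fun j hj => ?_
  rw [integral_const_mul, hmom j (Finset.mem_range.1 hj), mul_zero]

/-- Cancellation of an atom against one slice of the kernel. -/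
theorem norm_integral_slice_le {lam : ℝ} (hl : 0 < lam) (hδ0 : 0 < δ) (hδ : δ < 1 / 2)
    (hm : Measurable b) (hb : ∀ t, ‖b t‖ ≤ 1)
    (hs : ∀ t, t ∉ Set.Ioo (1 - δ) (1 + δ) → b t = 0) {k : ℕ}
    (hmom : ∀ j < k, ∫ t : ℝ, (t : ℂ) ^ j * b t * ((|t| ^ (2 * lam) : ℝ) : ℂ) = 0)
    {x s : ℝ} (hx : 8 * δ < |(|x| - 1)|) (h1 : -1 ≤ s) (h2 : s ≤ 1) :
    ‖∫ t : ℝ, b t * (((x - t) * quad x t s ^ (-(lam + 1)) * |t| ^ (2 * lam) : ℝ) : ℂ)‖ ≤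
      4 * 2 ^ (2 * lam) * (16 / 7) ^ (lam + 1) * 8 ^ k * δ ^ (k + 1) * (|(|x| - 1)|⁻¹) ^ k *
        (|x - 1| * quad x 1 s ^ (-(lam + 1))) := by
  set D := |(|x| - 1)| with hDdef
  have hD : 0 < D := by linarith
  have hx1 : |x| ≠ |(1 : ℝ)| := by
    rw [abs_one]
    intro h
    rw [hDdef, h, sub_self, abs_zero] at hD
    exact lt_irrefl _ hD
  have hq := quad_pos h1 h2 hx1
  set w : ℂ → ℂ := fun z => (x : ℂ) ^ 2 + z ^ 2 - 2 * x * z * s with hw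
  -- The slice is extended to complex t. On the disc of radius D/4 the real part of w stays above
  -- (7/16) quad > 0, so the principal branch of the power is holomorphic and bounded there.
  set φ : ℂ → ℂ := fun z => (x - z) * w z ^ ((-(lam + 1) : ℝ) : ℂ) with hφ
  have hR : 0 < D / 4 := by positivity
  have hwre : ∀ z ∈ Metric.ball (1 : ℂ) (D / 4), 7 / 16 * quad x 1 s ≤ (w z).re := fun z hz => by
    rw [Metric.mem_ball, dist_eq_norm] at hz
    have := norm_quad_sub_le h1 h2 hz.le
    have h3 := (Complex.abs_re_le_norm _).trans this
    rw [Complex.sub_re, Complex.ofReal_re] at h3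
    have := (abs_le.1 h3).1
    simp only [hw]
    linarith
  have hdiff : DifferentiableOn ℂ φ (Metric.ball 1 (D / 4)) := by
    intro z hz
    have h3 := hwre z hz
    have h4 : w z ∈ Complex.slitPlane := Or.inl (by nlinarith)
    refine (DifferentiableAt.mul (by fun_prop) ?_).differentiableWithinAt
    exact DifferentiableAt.cpow (by simp only [hw]; fun_prop) (by fun_prop) h4
  have hdist : D ≤ |x - 1| := by
    have := abs_abs_sub_abs_le_abs_sub x 1
    rwa [abs_one] at this
  have hbound : ∀ z ∈ Metric.ball (1 : ℂ) (D / 4),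
      ‖φ z‖ ≤ 2 * |x - 1| * ((16 / 7) ^ (lam + 1) * quad x 1 s ^ (-(lam + 1))) := fun z hz => by
    have h3 := hwre z hz
    have hp : 0 < 7 / 16 * quad x 1 s := by positivity
    rw [Metric.mem_ball, dist_eq_norm] at hz
    rw [norm_mul, Complex.norm_cpow_real]
    refine mul_le_mul ?_ ?_ (by positivity) (by positivity)
    · calc ‖(x : ℂ) - z‖ = ‖((x - 1 : ℝ) : ℂ) - (z - 1)‖ := by
            congr 1
            push_cast
            ring
        _ ≤ |x - 1| + ‖z - 1‖ := by
            refine (norm_sub_le _ _).trans ?_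
            rw [Complex.norm_real, Real.norm_eq_abs]
        _ ≤ 2 * |x - 1| := by linarith
    · calc ‖w z‖ ^ (-(lam + 1)) ≤ (7 / 16 * quad x 1 s) ^ (-(lam + 1)) :=
            Real.rpow_le_rpow_of_nonpos hp (h3.trans (Complex.re_le_norm _)) (by linarith)
        _ = _ := by
            rw [Real.mul_rpow (by norm_num) hq.le, Real.rpow_neg (by norm_num : (0:ℝ) ≤ 7 / 16),
              ← Real.inv_rpow (by norm_num)]
            norm_num
  obtain ⟨Q, g, hQ, -, hg, htay⟩ := exists_taylor hR hdiff hbound k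
  set B := 2 * |x - 1| * ((16 / 7) ^ (lam + 1) * quad x 1 s ^ (-(lam + 1))) with hBdef
  have hB0 : 0 ≤ B := by positivity
  obtain ⟨hQi, hQ0⟩ := integral_mul_polynomial_eq_zero hl hδ0 hδ hm hb hs hmom hQ
  -- F is the Taylor remainder times the weight, at most δ^k B (8/D)^k 2^(2λ) on the support; the
  -- polynomial integrates to zero. The support has length 2δ, whence δ^(k+1).
  set F : ℝ → ℂ := fun t => (((x - t) * quad x t s ^ (-(lam + 1)) * |t| ^ (2 * lam) : ℝ) : ℂ) -
    Q.eval (t : ℂ) * ((|t| ^ (2 * lam) : ℝ) : ℂ) with hF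
  have hball : ∀ t ∈ Set.Ioo (1 - δ) (1 + δ), (t : ℂ) ∈ Metric.ball (1 : ℂ) (D / 4) ∧
      ‖(t : ℂ) - 1‖ ≤ δ := fun t ht => by
    have : ‖(t : ℂ) - 1‖ ≤ δ := by
      rw [← Complex.ofReal_one, ← Complex.ofReal_sub, Complex.norm_real, Real.norm_eq_abs, abs_le]
      constructor <;> linarith [ht.1, ht.2]
    refine ⟨?_, this⟩
    rw [Metric.mem_ball, dist_eq_norm]
    linarith
  have hFb : ∀ t ∈ Set.Ioo (1 - δ) (1 + δ), ‖F t‖ ≤ δ ^ k * (B * (2 / (D / 4)) ^ k) * 2 ^ (2 * lam) :=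
    fun t ht => by
      obtain ⟨hz, hz'⟩ := hball t ht
      have hwt : w t = (quad x t s : ℂ) := by
        simp only [hw, quad]
        push_cast
        ring
      have hqt : 0 ≤ quad x t s := (sq_nonneg _).trans (sq_le_quad x t h1 h2)
      have e : F t = ((t : ℂ) - 1) ^ k * g t * ((|t| ^ (2 * lam) : ℝ) : ℂ) := by
        have h3 := htay t hz
        simp only [hφ] at h3
        rw [hwt, ← Complex.ofReal_cpow hqt] at h3
        simp only [hF]
        rw [Complex.ofReal_mul, Complex.ofReal_mul, Complex.ofReal_sub, h3]
        ring
      have ht2 : |t| ≤ 2 := by rw [abs_le]; constructor <;> linarith [ht.1, ht.2]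
      rw [e, norm_mul, norm_mul, norm_pow, Complex.norm_real, Real.norm_of_nonneg (by positivity)]
      have := hg t hz
      gcongr
  have hFm : Measurable F := by
    simp only [hF]
    have : Measurable fun t : ℝ => (((x - t) * quad x t s ^ (-(lam + 1)) * |t| ^ (2 * lam) : ℝ) : ℂ) := by
      unfold quad
      fun_prop
    have h3 : Measurable fun t : ℝ => Q.eval (t : ℂ) :=
      (Q.continuous.comp Complex.continuous_ofReal).measurable
    exact this.sub (h3.mul (by fun_prop))
  obtain ⟨hFi, hFn⟩ := integrable_mul_of_bound hm hb (by linarith) hs hFm hFb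
  have e : ∀ t : ℝ, b t * (((x - t) * quad x t s ^ (-(lam + 1)) * |t| ^ (2 * lam) : ℝ) : ℂ) =
      b t * F t + b t * (Q.eval (t : ℂ) * ((|t| ^ (2 * lam) : ℝ) : ℂ)) := fun t => by
    simp only [hF]
    ring
  simp only [e]
  rw [integral_add hFi hQi, hQ0, add_zero]
  refine hFn.trans (le_of_eq ?_)
  rw [hBdef, show 2 / (D / 4) = 8 * D⁻¹ by field_simp; norm_num, mul_pow]
  ring

/-- Fubini in (s, t). It applies because 8δ < ||x| - 1| keeps quad at least δ² on the support of b.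
-/
theorem integral_mul_kernel_eq {lam : ℝ} (hl : 0 < lam) (hδ0 : 0 < δ) (hδ : δ < 1 / 2)
    (hm : Measurable b) (hb : ∀ t, ‖b t‖ ≤ 1)
    (hs : ∀ t, t ∉ Set.Ioo (1 - δ) (1 + δ) → b t = 0) {x : ℝ} (hx : 8 * δ < |(|x| - 1)|) :
    ∫ t : ℝ, b t * (hilbertKernel lam x t : ℂ) * ((|t| ^ (2 * lam) : ℝ) : ℂ) =
      kernelConst lam * ∫ s in Set.Ioc (-1 : ℝ) 1, (weight lam s : ℂ) *
        ∫ t : ℝ, b t * (((x - t) * quad x t s ^ (-(lam + 1)) * |t| ^ (2 * lam) : ℝ) : ℂ) := by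
  set D := |(|x| - 1)| with hDdef
  set G : ℝ → ℝ → ℂ := fun s t => (weight lam s : ℂ) *
    (b t * (((x - t) * quad x t s ^ (-(lam + 1)) * |t| ^ (2 * lam) : ℝ) : ℂ)) with hG
  have hbi := integrable_of_bounded_support hm.aestronglyMeasurable hb hs
  set μ := volume.restrict (Set.Ioc (-1 : ℝ) 1) with hμ
  have hGi : Integrable (Function.uncurry G) (μ.prod volume) := by
    have hw : Integrable (weight lam) μ := (intervalIntegrable_weight hl).1
    refine ((hw.mul_prod hbi.norm).mul_const
      ((|x| + 2) * (δ ^ 2) ^ (-(lam + 1)) * 2 ^ (2 * lam))).mono' ?_ ?_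
    · refine Measurable.aestronglyMeasurable ?_
      simp only [hG]
      unfold Function.uncurry weight quad
      fun_prop
    · have h1 : ∀ᵐ s ∂μ, s ∈ Set.Ioc (-1 : ℝ) 1 := ae_restrict_mem measurableSet_Ioc
      have h2 : ∀ᵐ z ∂(μ.prod (volume : Measure ℝ)), z.1 ∈ Set.Ioc (-1 : ℝ) 1 :=
        Measure.quasiMeasurePreserving_fst.ae h1
      filter_upwards [h2] with z hz
      simp only [Function.uncurry, hG]
      rw [norm_mul, norm_mul, Complex.norm_real, Complex.norm_real,
        Real.norm_of_nonneg (weight_nonneg lam hz.1.le hz.2), ← mul_assoc]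
      by_cases ht : z.2 ∈ Set.Ioo (1 - δ) (1 + δ)
      · refine mul_le_mul_of_nonneg_left ?_
          (mul_nonneg (weight_nonneg lam hz.1.le hz.2) (norm_nonneg _))
        have h3 : δ ^ 2 ≤ quad x z.2 z.1 := by
          refine le_trans ?_ (sq_le_quad x z.2 hz.1.le hz.2)
          rw [abs_of_pos (show 0 < z.2 by linarith [ht.1])]
          refine sq_le_sq.2 ?_
          rw [abs_of_pos hδ0]
          have h4 : |(|x| - 1)| ≤ |(|x| - z.2)| + |z.2 - 1| := by
            have := abs_add_le (|x| - z.2) (z.2 - 1)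
            rwa [sub_add_sub_cancel] at this
          have h5 : |z.2 - 1| ≤ δ := by rw [abs_le]; constructor <;> linarith [ht.1, ht.2]
          linarith
        have h4 : |z.2| ≤ 2 := by rw [abs_le]; constructor <;> linarith [ht.1, ht.2]
        have h5 : |x - z.2| ≤ |x| + 2 := (abs_sub _ _).trans (by linarith)
        have h6 : quad x z.2 z.1 ^ (-(lam + 1)) ≤ (δ ^ 2) ^ (-(lam + 1)) :=
          Real.rpow_le_rpow_of_nonpos (by positivity) h3 (by linarith)
        have h7 : 0 ≤ quad x z.2 z.1 := (sq_nonneg δ).trans h3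
        rw [norm_mul, norm_mul, Real.norm_eq_abs, Real.norm_of_nonneg (Real.rpow_nonneg h7 _),
          Real.norm_of_nonneg (by positivity)]
        gcongr
      · rw [hs _ ht, norm_zero, mul_zero, zero_mul, zero_mul]
  have hswap := integral_integral_swap hGi
  have hL : ∀ s, ∫ t, G s t = (weight lam s : ℂ) *
      ∫ t : ℝ, b t * (((x - t) * quad x t s ^ (-(lam + 1)) * |t| ^ (2 * lam) : ℝ) : ℂ) := fun s => by
    simp only [hG]
    rw [integral_const_mul]
  simp only [hL] at hswap
  rw [hswap, ← integral_const_mul]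
  congr 1
  ext t
  have e : ∀ s ∈ Set.Ioc (-1 : ℝ) 1, G s t = (b t * (((x - t) * |t| ^ (2 * lam) : ℝ) : ℂ)) *
      ((weight lam s / quad x t s ^ (lam + 1) : ℝ) : ℂ) := fun s hs' => by
    simp only [hG]
    rw [Real.rpow_neg ((sq_nonneg _).trans (sq_le_quad x t hs'.1.le hs'.2))]
    push_cast
    ring
  rw [setIntegral_congr_fun measurableSet_Ioc e, integral_const_mul, integral_complex_ofReal,
    hilbertKernel_eq, kernelIntegral, intervalIntegral.integral_of_le (by norm_num)]
  push_cast
  ring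

/-- Size of the transform of an atom away from the support and its reflection. -/
theorem exists_far_bound {lam : ℝ} (hl : 0 < lam) (k : ℕ) : ∃ C : ℝ, 0 < C ∧
    ∀ (b : ℝ → ℂ) (δ : ℝ), 0 < δ → δ < 1 / 2 → Measurable b → (∀ t, ‖b t‖ ≤ 1) →
    (∀ t, t ∉ Set.Ioo (1 - δ) (1 + δ) → b t = 0) →
    (∀ j < k, ∫ t : ℝ, (t : ℂ) ^ j * b t * ((|t| ^ (2 * lam) : ℝ) : ℂ) = 0) →
    ∀ x : ℝ, 8 * δ < |(|x| - 1)| →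
      ‖∫ t : ℝ, b t * (hilbertKernel lam x t : ℂ) * ((|t| ^ (2 * lam) : ℝ) : ℂ)‖ ≤
        C * (δ ^ (k + 1) * (|(|x| - 1)|⁻¹) ^ (k + 1) * (1 + |x|) ^ (-(2 * lam))) := by
  obtain ⟨C₀, hC₀, hsize⟩ := kernelIntegral_size hl
  refine ⟨(|kernelConst lam| + 1) * (4 * 2 ^ (2 * lam) * (16 / 7) ^ (lam + 1) * 8 ^ k * C₀),
    by positivity, fun b δ hδ0 hδ hm hb hs hmom x hx => ?_⟩
  set E := 4 * 2 ^ (2 * lam) * (16 / 7) ^ (lam + 1) * 8 ^ k * δ ^ (k + 1) * (|(|x| - 1)|⁻¹) ^ k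
    with hE
  have hE0 : 0 ≤ E := by positivity
  have hx1 : |x| ≠ 1 := by
    intro h
    rw [h, sub_self, abs_zero] at hx
    linarith
  have hD : 0 < |(|x| - 1)| := by linarith
  rw [integral_mul_kernel_eq hl hδ0 hδ hm hb hs hx, norm_mul, Complex.norm_real, Real.norm_eq_abs]
  have hi : IntegrableOn (fun s => weight lam s / quad x 1 s ^ (lam + 1)) (Set.Ioc (-1) 1) :=
    (intervalIntegrable_div_quad lam (by simpa using hx1) (intervalIntegrable_weight hl)).1
  -- Integrating the slice bounds against the weight reassembles the kernel integral at t = 1, whose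
  -- size estimate supplies the last factor D⁻¹.
  have key : ‖∫ s in Set.Ioc (-1 : ℝ) 1, (weight lam s : ℂ) *
      ∫ t : ℝ, b t * (((x - t) * quad x t s ^ (-(lam + 1)) * |t| ^ (2 * lam) : ℝ) : ℂ)‖ ≤
      E * (|x - 1| * kernelIntegral lam x 1) := by
    rw [kernelIntegral, intervalIntegral.integral_of_le (by norm_num), ← integral_const_mul,
      ← integral_const_mul]
    refine norm_integral_le_of_norm_le ((hi.const_mul _).const_mul _) ?_
    filter_upwards [ae_restrict_mem measurableSet_Ioc] with s hs'
    have h1 := norm_integral_slice_le hl hδ0 hδ hm hb hs hmom hx hs'.1.le hs'.2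
    have h2 := weight_nonneg lam hs'.1.le hs'.2
    rw [norm_mul, Complex.norm_real, Real.norm_of_nonneg h2]
    refine (mul_le_mul_of_nonneg_left h1 h2).trans (le_of_eq ?_)
    rw [Real.rpow_neg ((sq_nonneg _).trans (sq_le_quad x 1 hs'.1.le hs'.2))]
    ring
  calc _ ≤ (|kernelConst lam| + 1) *
        (E * (C₀ * (1 + |x|) ^ (-(2 * lam)) * |(|x| - 1)|⁻¹)) := by
        refine mul_le_mul (by linarith) (key.trans ?_) (norm_nonneg _) (by positivity)
        exact mul_le_mul_of_nonneg_left (hsize x hx1) hE0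
    _ = _ := by
        rw [hE, pow_succ (|(|x| - 1)|⁻¹) k]
        ring

end

/-! ### The transform near the support and its reflection -/

theorem measurableSet_trunc (ε x : ℝ) : MeasurableSet {t : ℝ | ε < |t - x|} :=
  measurableSet_lt measurable_const (measurable_id.sub_const x).abs

/-- Off the support, the truncated transforms are eventually constant. -/
theorem tendsto_truncatedHilbert_off_support (lam : ℝ) {b : ℝ → ℂ} {x η : ℝ} (hη : 0 < η)
    (hs : ∀ t, |t - x| ≤ η → b t = 0) : Tendsto (truncatedHilbert lam b x) (𝓝[>] (0 : ℝ))
      (𝓝 (c lam * ∫ t : ℝ, b t * (hilbertKernel lam x t : ℂ) * ((|t| ^ (2 * lam) : ℝ) : ℂ))) := by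
  refine tendsto_const_nhds.congr' ?_
  filter_upwards [Ioo_mem_nhdsGT hη] with ε hε
  rw [truncatedHilbert, setIntegral_eq_integral_of_forall_compl_eq_zero]
  intro t ht
  rw [hs t ((not_lt.1 ht).trans hε.2.le), zero_mul, zero_mul]

theorem tendsto_setIntegral_trunc {F : ℝ → ℂ} (hF : Integrable F) (x : ℝ) :
    Tendsto (fun ε : ℝ => ∫ t in {t : ℝ | ε < |t - x|}, F t) (𝓝[>] 0) (𝓝 (∫ t, F t)) := by
  simp only [← integral_indicator (measurableSet_trunc _ x)]
  refine tendsto_integral_filter_of_dominated_convergence (fun t => ‖F t‖) ?_ ?_ hF.norm ?_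
  · exact Eventually.of_forall fun ε => hF.aestronglyMeasurable.indicator (measurableSet_trunc ε x)
  · exact Eventually.of_forall fun ε => ae_of_all _ fun t => norm_indicator_le_norm_self F t
  · filter_upwards [Measure.ae_ne volume x] with t ht
    refine tendsto_const_nhds.congr' ?_
    filter_upwards [Ioo_mem_nhdsGT (abs_pos.2 (sub_ne_zero.2 ht))] with ε hε
    rw [Set.indicator_of_mem (show t ∈ {t : ℝ | ε < |t - x|} from hε.2)]

theorem integrable_truncated_abs_rpow {r N : ℝ} (hr : -1 < r) (hN : 0 ≤ N) :
    Integrable ((Set.Icc (-N) N).indicator fun u : ℝ => |u| ^ r) := by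
  rw [integrable_indicator_iff measurableSet_Icc,
    ← intervalIntegrable_iff_integrableOn_Icc_of_le (by linarith)]
  have h1 : IntervalIntegrable (fun u : ℝ => |u| ^ r) volume 0 N := by
    refine (intervalIntegral.intervalIntegrable_rpow' hr).congr fun u hu => ?_
    rw [Set.uIoc_of_le hN] at hu
    rw [abs_of_pos hu.1]
  have h2 := ((IntervalIntegrable.iff_comp_neg (f := fun u : ℝ => |u| ^ r)).1 h1).symm
  simp only [abs_neg, neg_zero] at h2
  exact h2.trans h1

/-- Existence and size of the transform near the support and its reflection. -/
theorem exists_near_bound {lam : ℝ} (hl : 0 < lam) : ∃ C : ℝ, 0 < C ∧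
    ∀ (b : ℝ → ℂ) (δ : ℝ), 0 < δ → δ < 1 / 2 → Measurable b → (∀ t, ‖b t‖ ≤ 1) →
    (∀ t, t ∉ Set.Ioo (1 - δ) (1 + δ) → b t = 0) →
    ∃ g : ℝ → ℂ, Measurable g ∧
      ∫⁻ x, ENNReal.ofReal (‖g x‖ ^ 2) ≤ ENNReal.ofReal (4 * Real.pi ^ 2 * δ) ∧
      ∀ᵐ x : ℝ, |(|x| - 1)| ≤ 8 * δ → ∃ L : ℂ,
        Tendsto (truncatedHilbert lam b x) (𝓝[>] (0 : ℝ)) (𝓝 L) ∧ ‖L‖ ≤ C * (1 + ‖g x‖) := by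
  obtain ⟨C₁, hC₁, herr⟩ := kernel_error_bound hl
  obtain ⟨C₂, hC₂, href⟩ := kernel_reflected_bound hl
  -- Since |x| ≤ 5 and 1/2 < t < 3/2, the difference |x| - t lies in [-5, 5]; a translate of κ
  -- dominates the reflected kernel with an integral independent of x.
  set κ : ℝ → ℝ := (Set.Icc (-5 : ℝ) 5).indicator fun u : ℝ => |u| ^ (-(1 / 2) : ℝ) with hκ
  have hκi : Integrable κ := integrable_truncated_abs_rpow (by norm_num) (by norm_num)
  have hκ0 : ∀ u, 0 ≤ κ u := fun u => Set.indicator_nonneg (fun u _ => by positivity) u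
  set I := ∫ u, κ u with hI
  have hI0 : 0 ≤ I := integral_nonneg hκ0
  set A := |c lam| * |kernelConst lam| with hA
  refine ⟨A * lam⁻¹ + A * C₁ + A * (C₂ * I) + 1, by positivity,
    fun b δ hδ0 hδ hm hb hs => ?_⟩
  obtain ⟨g, hgm, hgt, hgb⟩ := exists_classical_limit_complex hm hb (by linarith) hs
  refine ⟨g, hgm, hgb.trans (ENNReal.ofReal_le_ofReal (by linarith)), ?_⟩
  have hsupp : ∀ t, b t ≠ 0 → 1 / 2 < t ∧ t < 3 / 2 := fun t ht => by
    have : t ∈ Set.Ioo (1 - δ) (1 + δ) := by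
      by_contra h
      exact ht (hs t h)
    constructor <;> linarith [this.1, this.2]
  filter_upwards [hgt] with x hx hD
  have hx5 : |x| ≤ 5 := by linarith [(abs_le.1 hD).2]
  have hA0 : 0 ≤ A := by positivity
  have hAL : 0 ≤ A * lam⁻¹ := by positivity
  have hAC : 0 ≤ A * C₁ := by positivity
  have hACI : 0 ≤ A * (C₂ * I) := by positivity
  have hg0 := norm_nonneg (g x)
  rcases lt_or_ge 0 x with h0 | h0
  · rw [abs_of_pos h0] at hx5
    set E : ℝ → ℝ := fun t => |t| ^ (2 * lam) * ((x - t) * kernelIntegral lam x t) -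
      lam⁻¹ * (1 / (x - t)) with hE
    have hEm : Measurable E := by
      have := measurable_kernelIntegral lam x
      simp only [hE]
      fun_prop
    have hEb : ∀ t ∈ Set.Ioo (1 - δ) (1 + δ), ‖(E t : ℂ)‖ ≤ C₁ := fun t ht => by
      have ht1 : 1 / 2 < t := by linarith [ht.1]
      rw [Complex.norm_real, Real.norm_eq_abs]
      simp only [hE]
      -- At t = x both terms of E vanish, the second because 1/0 = 0.
      rcases eq_or_ne x t with h | h
      · rw [h, sub_self]
        simpa using hC₁
      · rw [abs_of_pos (show 0 < t by linarith)]
        exact herr x t h0.le hx5 ht1 (by linarith [ht.2]) h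
    obtain ⟨hEi, hEn⟩ := integrable_mul_of_bound hm hb (by linarith) hs
      (F := fun t => (E t : ℂ)) (by fun_prop) hEb
    have hbi := integrable_of_bounded_support hm.aestronglyMeasurable hb hs
    refine ⟨c lam * (kernelConst lam * ((lam⁻¹ : ℝ) * g x + ∫ t, b t * (E t : ℂ))), ?_, ?_⟩
    · have h1 := (((hx.const_mul ((lam⁻¹ : ℝ) : ℂ)).add (tendsto_setIntegral_trunc hEi x)).const_mul
        (kernelConst lam : ℂ)).const_mul (c lam : ℂ)
      refine h1.congr' ?_
      filter_upwards [self_mem_nhdsWithin] with ε hε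
      have hε : (0 : ℝ) < ε := hε
      have hint : IntegrableOn (fun t => b t * ((1 / (x - t) : ℝ) : ℂ)) {t : ℝ | ε < |t - x|} := by
        refine hbi.integrableOn.mul_bdd (c := ε⁻¹) (by fun_prop : Measurable _).aestronglyMeasurable ?_
        filter_upwards [ae_restrict_mem (measurableSet_trunc ε x)] with t ht
        rw [Complex.norm_real, norm_div, norm_one, one_div, Real.norm_eq_abs, abs_sub_comm]
        exact inv_anti₀ hε (le_of_lt ht)
      rw [truncatedHilbert, ← integral_const_mul, ← integral_add (hint.const_mul _) hEi.integrableOn,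
        ← integral_const_mul]
      congr 2
      ext t
      simp only [hE]
      rw [hilbertKernel_eq]
      push_cast
      ring
    · rw [norm_mul, norm_mul, Complex.norm_real, Complex.norm_real, ← mul_assoc, Real.norm_eq_abs,
        Real.norm_eq_abs, ← hA]
      have h2 : ‖((lam⁻¹ : ℝ) : ℂ) * g x + ∫ t, b t * (E t : ℂ)‖ ≤ lam⁻¹ * ‖g x‖ + C₁ := by
        refine (norm_add_le _ _).trans (add_le_add ?_ (hEn.trans ?_))
        · rw [norm_mul, Complex.norm_real, Real.norm_of_nonneg (by positivity)]
        · nlinarith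
      calc _ ≤ A * (lam⁻¹ * ‖g x‖ + C₁) := mul_le_mul_of_nonneg_left h2 hA0
        _ ≤ _ := by nlinarith
  -- For x ≤ 0 the support lies at distance more than 1/2 from x, so no principal value is involved.
  · refine ⟨_, tendsto_truncatedHilbert_off_support lam (η := 1 / 2) (by norm_num)
      fun t ht => ?_, ?_⟩
    · by_contra h
      have := (hsupp t h).1
      linarith [le_abs_self (t - x)]
    · have key : ‖∫ t : ℝ, b t * (hilbertKernel lam x t : ℂ) * ((|t| ^ (2 * lam) : ℝ) : ℂ)‖ ≤
          |kernelConst lam| * (C₂ * I) := by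
        have hint : Integrable fun t => |kernelConst lam| * (C₂ * κ (|x| - t)) :=
          ((hκi.comp_sub_left |x|).const_mul _).const_mul _
        refine (norm_integral_le_of_norm_le hint ?_).trans (le_of_eq ?_)
        · filter_upwards [Measure.ae_ne volume |x|] with t ht
          by_cases hbt : b t = 0
          · rw [hbt, zero_mul, zero_mul, norm_zero]
            have := hκ0 (|x| - t)
            positivity
          · obtain ⟨h1, h2⟩ := hsupp t hbt
            have h3 := href x t h0 (by linarith [(abs_le.1 hx5).1]) h1 h2 ht.symm
            have h4 : κ (|x| - t) = |(|x| - t)| ^ (-(1 / 2) : ℝ) := by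
              rw [hκ, Set.indicator_of_mem]
              constructor <;> linarith [abs_nonneg x]
            have e : b t * (hilbertKernel lam x t : ℂ) * ((|t| ^ (2 * lam) : ℝ) : ℂ) =
                b t * ((kernelConst lam * (t ^ (2 * lam) * ((x - t) * kernelIntegral lam x t)) :
                  ℝ) : ℂ) := by
              rw [hilbertKernel_eq, abs_of_pos (show 0 < t by linarith)]
              push_cast
              ring
            rw [e, norm_mul, Complex.norm_real, norm_mul, Real.norm_eq_abs, Real.norm_eq_abs, h4]
            refine (mul_le_of_le_one_left (by positivity) (hb t)).trans ?_
            exact mul_le_mul_of_nonneg_left h3 (abs_nonneg _)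
        · rw [integral_const_mul, integral_const_mul, integral_sub_left_eq_self κ volume]
      rw [norm_mul, Complex.norm_real, Real.norm_eq_abs]
      calc _ ≤ |c lam| * (|kernelConst lam| * (C₂ * I)) :=
            mul_le_mul_of_nonneg_left key (abs_nonneg _)
        _ = A * (C₂ * I) := by rw [hA]; ring
        _ ≤ _ := by nlinarith

/-! ### The normalised estimate -/

theorem lintegral_abs_sub_one_le {F : ℝ → ENNReal} (hF : Measurable F) :
    ∫⁻ x, F (|x| - 1) ≤ 2 * ∫⁻ v, F v := by
  calc ∫⁻ x, F (|x| - 1) ≤ ∫⁻ x, (F (x - 1) + F (-1 - x)) := by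
        refine lintegral_mono fun x => ?_
        rcases le_total 0 x with h | h
        · simp only [abs_of_nonneg h]
          exact le_self_add
        · simp only [abs_of_nonpos h]
          rw [show -x - 1 = -1 - x by ring]
          exact le_add_self
    _ = 2 * ∫⁻ v, F v := by
        rw [lintegral_add_left (by fun_prop), lintegral_sub_right_eq_self F 1,
          lintegral_sub_left_eq_self F (-1), two_mul]

theorem lintegral_abs_indicator_le {F : ℝ → ENNReal} (hF : Measurable F) {a : ℝ} :
    ∫⁻ v, {v : ℝ | a < |v|}.indicator (fun v => F |v|) v ≤ 2 * ∫⁻ u in Set.Ioi a, F u := by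
  rw [← lintegral_indicator measurableSet_Ioi]
  calc _ ≤ ∫⁻ v, ((Set.Ioi a).indicator F v + (Set.Ioi a).indicator F (0 - v)) := by
        refine lintegral_mono fun v => ?_
        by_cases h : a < |v|
        · rw [Set.indicator_of_mem (show v ∈ {v : ℝ | a < |v|} from h)]
          rcases le_total 0 v with h0 | h0
          · rw [abs_of_nonneg h0] at h ⊢
            rw [Set.indicator_of_mem (show v ∈ Set.Ioi a from h)]
            exact le_self_add
          · rw [abs_of_nonpos h0] at h ⊢
            rw [zero_sub, Set.indicator_of_mem (show -v ∈ Set.Ioi a from h)]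
            exact le_add_self
        · rw [Set.indicator_of_notMem (show v ∉ {v : ℝ | a < |v|} from h)]
          exact zero_le
    _ = _ := by
        rw [lintegral_add_left (hF.indicator measurableSet_Ioi),
          lintegral_sub_left_eq_self ((Set.Ioi a).indicator F) 0, two_mul]

/-- The condition q > 1 + m makes both powers integrable at infinity. The linear dependence on δ
comes from δ^q δ^(1-q) = δ and δ^q δ^(1+m-q) = δ^(1+m) ≤ δ. -/
theorem lintegral_tail_le {q m δ : ℝ} (hm : 0 ≤ m) (hq : 1 + m < q) (hδ0 : 0 < δ)
    (hδ : δ < 1 / 2) :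
    ∫⁻ u in Set.Ioi (8 * δ), ENNReal.ofReal (δ ^ q * (4 ^ m * u ^ (-q) + 2 ^ m * u ^ (m - q))) ≤
      ENNReal.ofReal ((4 ^ m * (8 ^ (1 - q) / (q - 1)) +
        2 ^ m * (8 ^ (1 + m - q) / (q - 1 - m))) * δ) := by
  have h8 : 0 < 8 * δ := by positivity
  have i1 := integrableOn_Ioi_rpow_of_lt (by linarith : -q < -1) h8
  have i2 := integrableOn_Ioi_rpow_of_lt (by linarith : m - q < -1) h8
  have i : IntegrableOn (fun u : ℝ => δ ^ q * (4 ^ m * u ^ (-q) + 2 ^ m * u ^ (m - q)))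
      (Set.Ioi (8 * δ)) := ((i1.const_mul _).add (i2.const_mul _)).const_mul _
  rw [← ofReal_integral_eq_lintegral_ofReal i]
  · refine ENNReal.ofReal_le_ofReal ?_
    rw [integral_const_mul, integral_add (i1.const_mul _) (i2.const_mul _), integral_const_mul,
      integral_const_mul, integral_Ioi_rpow_of_lt (by linarith) h8,
      integral_Ioi_rpow_of_lt (by linarith) h8, Real.mul_rpow (by norm_num) hδ0.le,
      Real.mul_rpow (by norm_num) hδ0.le]
    have e1 : δ ^ q * δ ^ (-q + 1) = δ := by
      rw [← Real.rpow_add hδ0]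
      norm_num
    have e2 : δ ^ q * δ ^ (m - q + 1) ≤ δ := by
      rw [← Real.rpow_add hδ0]
      calc δ ^ (q + (m - q + 1)) ≤ δ ^ (1 : ℝ) :=
            Real.rpow_le_rpow_of_exponent_ge hδ0 (by linarith) (by linarith)
        _ = δ := Real.rpow_one δ
    have p2 : 0 < q - 1 - m := by linarith
    calc _ = 4 ^ m * (8 ^ (1 - q) / (q - 1)) * (δ ^ q * δ ^ (-q + 1)) +
          2 ^ m * (8 ^ (1 + m - q) / (q - 1 - m)) * (δ ^ q * δ ^ (m - q + 1)) := by
          rw [show -q + 1 = 1 - q by ring, show m - q + 1 = 1 + m - q by ring,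
            show (1 - q) = -(q - 1) by ring, show 1 + m - q = -(q - 1 - m) by ring]
          simp only [neg_div_neg_eq]
          ring
      _ ≤ _ := by
          rw [e1, add_mul]
          gcongr
  · filter_upwards [ae_restrict_mem measurableSet_Ioi] with u hu
    have : 0 < u := h8.trans hu
    simp only [Pi.zero_apply]
    positivity

/-- The transform estimate for functions adapted to an interval around `1`. -/
theorem exists_core_bound {lam p : ℝ} (hl : 0 < lam) (hp0 : 0 < p) (hp1 : p ≤ 1) {k : ℕ}
    (hk : 1 + 2 * lam * (1 - p) < ((k : ℝ) + 1) * p) : ∃ C : ℝ, 0 < C ∧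
    ∀ (b : ℝ → ℂ) (δ : ℝ), 0 < δ → δ < 1 / 2 → Measurable b → (∀ t, ‖b t‖ ≤ 1) →
    (∀ t, t ∉ Set.Ioo (1 - δ) (1 + δ) → b t = 0) →
    (∀ j < k, ∫ t : ℝ, (t : ℂ) ^ j * b t * ((|t| ^ (2 * lam) : ℝ) : ℂ) = 0) →
    (∀ᵐ x : ℝ, Tendsto (truncatedHilbert lam b x) (𝓝[>] (0 : ℝ))
      (𝓝 (hilbertTransform lam b x))) ∧
    ∫⁻ x : ℝ, ENNReal.ofReal (‖hilbertTransform lam b x‖ ^ p * |x| ^ (2 * lam)) ≤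
      ENNReal.ofReal (C * δ) := by
  obtain ⟨C₁, hC₁, hnear⟩ := exists_near_bound hl
  obtain ⟨C₂, hC₂, hfar⟩ := exists_far_bound hl k
  -- In the far region the p-th power times the weight is bounded by δ^q D^(-q) (1 + |x|)^m: q
  -- measures the decay and m the surplus growth of the weight.
  set q := ((k : ℝ) + 1) * p with hq
  set m := 2 * lam * (1 - p) with hm
  have hm0 : 0 ≤ m := mul_nonneg (by linarith) (by linarith)
  set K₁ := C₁ ^ p * 2 * 5 ^ (2 * lam) with hK₁
  set K₂ := (|c lam| * C₂) ^ p with hK₂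
  set T := 4 ^ m * (8 ^ (1 - q) / (q - 1)) + 2 ^ m * (8 ^ (1 + m - q) / (q - 1 - m)) with hT
  have hT0 : 0 ≤ T := by
    have : 0 < q - 1 := by linarith
    have : 0 < q - 1 - m := by linarith
    positivity
  refine ⟨K₁ * 32 + K₁ * (4 * Real.pi ^ 2) + K₂ * (4 * T), by positivity,
    fun b δ hδ0 hδ hbm hb hs hmom => ?_⟩
  obtain ⟨g, hgm, hgb, hgt⟩ := hnear b δ hδ0 hδ hbm hb hs
  have key : ∀ᵐ x : ℝ, ∃ L : ℂ, Tendsto (truncatedHilbert lam b x) (𝓝[>] (0 : ℝ)) (𝓝 L) ∧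
      (|(|x| - 1)| ≤ 8 * δ → ‖L‖ ≤ C₁ * (1 + ‖g x‖)) ∧
      (8 * δ < |(|x| - 1)| → ‖L‖ ≤ |c lam| *
        (C₂ * (δ ^ (k + 1) * (|(|x| - 1)|⁻¹) ^ (k + 1) * (1 + |x|) ^ (-(2 * lam))))) := by
    filter_upwards [hgt] with x hx
    rcases le_or_gt |(|x| - 1)| (8 * δ) with h | h
    · obtain ⟨L, h1, h2⟩ := hx h
      exact ⟨L, h1, fun _ => h2, fun h' => absurd h' (not_lt.2 h)⟩
    · refine ⟨_, tendsto_truncatedHilbert_off_support lam hδ0 fun t ht => ?_,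
        fun h' => absurd h (not_lt.2 h'), fun _ => ?_⟩
      · by_contra hbt
        have ht' : t ∈ Set.Ioo (1 - δ) (1 + δ) := by
          by_contra h'
          exact hbt (hs t h')
        have h1 := abs_abs_sub_abs_le_abs_sub x 1
        rw [abs_one] at h1
        have h2 : |x - 1| ≤ |t - x| + |t - 1| := by
          rw [abs_sub_comm t x]
          have := abs_add_le (x - t) (t - 1)
          rwa [sub_add_sub_cancel] at this
        have h3 : |t - 1| ≤ δ := by rw [abs_le]; constructor <;> linarith [ht'.1, ht'.2]
        linarith
      · rw [norm_mul, Complex.norm_real, Real.norm_eq_abs]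
        exact mul_le_mul_of_nonneg_left (hfar b δ hδ0 hδ hbm hb hs hmom x h) (abs_nonneg _)
  refine ⟨?_, ?_⟩
  · filter_upwards [key] with x hx
    obtain ⟨L, h1, -⟩ := hx
    exact tendsto_nhds_limUnder ⟨L, h1⟩
  set S : Set ℝ := {x : ℝ | |(|x| - 1)| ≤ 8 * δ} with hS
  have hSm : MeasurableSet S := measurableSet_le (by fun_prop) measurable_const
  set F : ℝ → ENNReal := fun u =>
    ENNReal.ofReal (δ ^ q * (4 ^ m * u ^ (-q) + 2 ^ m * u ^ (m - q))) with hF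
  have hFm : Measurable F := by simp only [hF]; fun_prop
  set G : ℝ → ENNReal := {v : ℝ | 8 * δ < |v|}.indicator (fun v => F |v|) with hG
  have hGm : Measurable G := Measurable.indicator (by fun_prop)
    (measurableSet_lt measurable_const measurable_id.abs)
  have hpt : ∀ᵐ x : ℝ, ENNReal.ofReal (‖hilbertTransform lam b x‖ ^ p * |x| ^ (2 * lam)) ≤
      S.indicator (fun _ => ENNReal.ofReal K₁) x +
        (ENNReal.ofReal K₁ * ENNReal.ofReal (‖g x‖ ^ 2) + ENNReal.ofReal K₂ * G (|x| - 1)) := by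
    filter_upwards [key] with x hx
    obtain ⟨L, h1, h2, h3⟩ := hx
    have hL : hilbertTransform lam b x = L := h1.limUnder_eq
    rw [hL]
    rcases le_or_gt |(|x| - 1)| (8 * δ) with h | h
    · rw [Set.indicator_of_mem (show x ∈ S from h), ← add_assoc]
      refine le_add_right ?_
      rw [← ENNReal.ofReal_mul (by positivity), ← ENNReal.ofReal_add (by positivity) (by positivity)]
      refine ENNReal.ofReal_le_ofReal ?_
      have hx5 : |x| ≤ 5 := by linarith [(abs_le.1 h).2]
      have e1 : ‖L‖ ^ p ≤ C₁ ^ p * (2 * (1 + ‖g x‖ ^ 2)) := by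
        calc ‖L‖ ^ p ≤ (C₁ * (1 + ‖g x‖)) ^ p :=
              Real.rpow_le_rpow (norm_nonneg _) (h2 h) hp0.le
          _ = C₁ ^ p * (1 + ‖g x‖) ^ p := Real.mul_rpow hC₁.le (by positivity)
          -- Since 1 + |g| ≥ 1 and p ≤ 2, the power may be raised to 2. The L² bound then enters
          -- without Hölder's inequality, as the near set has measure O(δ).
          _ ≤ C₁ ^ p * (1 + ‖g x‖) ^ (2 : ℝ) := by
              gcongr
              · linarith [norm_nonneg (g x)]
              · linarith
          _ ≤ _ := by
              rw [Real.rpow_two]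
              gcongr
              nlinarith [sq_nonneg (1 - ‖g x‖)]
      have e2 : |x| ^ (2 * lam) ≤ 5 ^ (2 * lam) :=
        Real.rpow_le_rpow (abs_nonneg _) hx5 (by linarith)
      calc _ ≤ C₁ ^ p * (2 * (1 + ‖g x‖ ^ 2)) * 5 ^ (2 * lam) :=
            mul_le_mul e1 e2 (by positivity) (by positivity)
        _ = _ := by rw [hK₁]; ring
    · refine le_add_left (le_add_left ?_)
      rw [hG, Set.indicator_of_mem (show |x| - 1 ∈ {v : ℝ | 8 * δ < |v|} from h), hF]
      simp only
      rw [← ENNReal.ofReal_mul (by positivity)]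
      refine ENNReal.ofReal_le_ofReal ?_
      have h4 := h3 h
      set D := |(|x| - 1)| with hD
      have hD0 : 0 < D := by linarith
      have hx1 : 0 < 1 + |x| := by positivity
      have e1 : ‖L‖ ^ p ≤ K₂ * (δ ^ q * D ^ (-q) * (1 + |x|) ^ (-(2 * lam) * p)) := by
        refine (Real.rpow_le_rpow (norm_nonneg _) h4 hp0.le).trans (le_of_eq ?_)
        rw [← mul_assoc, Real.mul_rpow (by positivity) (by positivity),
          Real.mul_rpow (by positivity) (by positivity),
          Real.mul_rpow (by positivity) (by positivity),
          Real.mul_rpow (by positivity) (by positivity), ← Real.rpow_mul hx1.le,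
          ← Real.rpow_natCast, ← Real.rpow_natCast, ← Real.rpow_mul hδ0.le,
          ← Real.rpow_mul (by positivity), Real.inv_rpow hD0.le, ← Real.rpow_neg hD0.le]
        rw [hK₂, Real.mul_rpow (abs_nonneg _) hC₂.le, hq]
        push_cast
        ring_nf
      have e2 : (1 + |x|) ^ (-(2 * lam) * p) * |x| ^ (2 * lam) ≤ 4 ^ m + 2 ^ m * D ^ m := by
        calc (1 + |x|) ^ (-(2 * lam) * p) * |x| ^ (2 * lam)
            ≤ (1 + |x|) ^ (-(2 * lam) * p) * (1 + |x|) ^ (2 * lam) := by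
              gcongr
              linarith
          _ = (1 + |x|) ^ m := by
              rw [← Real.rpow_add hx1]
              congr 1
              rw [hm]
              ring
          -- As 1 + |x| ≤ 2 + D, the growth is at most 4^m when D ≤ 2 and at most (2D)^m otherwise.
          _ ≤ (2 + D) ^ m :=
              Real.rpow_le_rpow hx1.le (by linarith [le_abs_self (|x| - 1)]) hm0
          _ ≤ 4 ^ m + 2 ^ m * D ^ m := by
              have p4 : (0 : ℝ) ≤ 4 ^ m := by positivity
              have pD : 0 ≤ 2 ^ m * D ^ m := by positivity
              rcases le_total D 2 with h | h
              · have : (2 + D) ^ m ≤ 4 ^ m := Real.rpow_le_rpow (by positivity) (by linarith) hm0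
                linarith
              · have : (2 + D) ^ m ≤ (2 * D) ^ m :=
                  Real.rpow_le_rpow (by positivity) (by linarith) hm0
                rw [Real.mul_rpow (by norm_num) hD0.le] at this
                linarith
      calc ‖L‖ ^ p * |x| ^ (2 * lam)
          ≤ K₂ * (δ ^ q * D ^ (-q) * (1 + |x|) ^ (-(2 * lam) * p)) * |x| ^ (2 * lam) :=
            mul_le_mul_of_nonneg_right e1 (by positivity)
        _ = K₂ * (δ ^ q * D ^ (-q) * ((1 + |x|) ^ (-(2 * lam) * p) * |x| ^ (2 * lam))) := by ring
        _ ≤ K₂ * (δ ^ q * D ^ (-q) * (4 ^ m + 2 ^ m * D ^ m)) := by gcongr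
        _ = _ := by
            rw [show m - q = m + -q by ring, Real.rpow_add hD0]
            ring
  have hvol : volume S ≤ ENNReal.ofReal (32 * δ) := by
    have hsub : S ⊆ Set.Icc (1 - 8 * δ) (1 + 8 * δ) ∪ Set.Icc (-1 - 8 * δ) (-1 + 8 * δ) := by
      intro x hx
      have h := abs_le.1 (show |(|x| - 1)| ≤ 8 * δ from hx)
      rcases le_total 0 x with h0 | h0
      · rw [abs_of_nonneg h0] at h
        exact Or.inl ⟨by linarith, by linarith⟩
      · rw [abs_of_nonpos h0] at h
        exact Or.inr ⟨by linarith, by linarith⟩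
    refine (measure_mono hsub).trans ((measure_union_le _ _).trans ?_)
    rw [Real.volume_Icc, Real.volume_Icc, ← ENNReal.ofReal_add (by linarith) (by linarith)]
    exact ENNReal.ofReal_le_ofReal (by linarith)
  have hGint : ∫⁻ x, G (|x| - 1) ≤ ENNReal.ofReal (4 * T * δ) := by
    refine (lintegral_abs_sub_one_le hGm).trans ?_
    calc 2 * ∫⁻ v, G v ≤ 2 * (2 * ENNReal.ofReal (T * δ)) :=
          mul_le_mul_right ((lintegral_abs_indicator_le hFm).trans
            (mul_le_mul_right (lintegral_tail_le hm0 hk hδ0 hδ) 2)) 2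
      _ = ENNReal.ofReal (4 * T * δ) := by
          rw [← ENNReal.ofReal_ofNat 2, ← ENNReal.ofReal_mul (by norm_num),
            ← ENNReal.ofReal_mul (by norm_num)]
          congr 1
          ring
  calc _ ≤ _ := lintegral_mono_ae hpt
    _ = ENNReal.ofReal K₁ * volume S + (ENNReal.ofReal K₁ * (∫⁻ x, ENNReal.ofReal (‖g x‖ ^ 2)) +
          ENNReal.ofReal K₂ * ∫⁻ x, G (|x| - 1)) := by
        rw [lintegral_add_left (measurable_const.indicator hSm), lintegral_add_left (by fun_prop),
          lintegral_indicator_const hSm, lintegral_const_mul _ (by fun_prop),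
          lintegral_const_mul _ (by fun_prop)]
    _ ≤ ENNReal.ofReal K₁ * ENNReal.ofReal (32 * δ) +
          (ENNReal.ofReal K₁ * ENNReal.ofReal (4 * Real.pi ^ 2 * δ) +
          ENNReal.ofReal K₂ * ENNReal.ofReal (4 * T * δ)) := by gcongr
    _ = _ := by
        rw [← ENNReal.ofReal_mul (by positivity), ← ENNReal.ofReal_mul (by positivity),
          ← ENNReal.ofReal_mul (by positivity), ← ENNReal.ofReal_add (by positivity) (by positivity),
          ← ENNReal.ofReal_add (by positivity) (by positivity)]
        congr 1
        ring

/-! ### Dilations and normalisation of atoms -/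

theorem lintegral_comp_div {a : ℝ} (ha : a ≠ 0) (F : ℝ → ENNReal) :
    ∫⁻ x, F (x / a) = ENNReal.ofReal |a| * ∫⁻ x, F x := by
  have h1 := Real.map_volume_mul_right (inv_ne_zero ha)
  rw [inv_inv] at h1
  rw [← smul_eq_mul, ← lintegral_smul_measure, ← h1]
  have h2 := lintegral_map_equiv (μ := volume) F
    (Homeomorph.mulRight₀ a⁻¹ (inv_ne_zero ha)).toMeasurableEquiv
  simp only [Homeomorph.toMeasurableEquiv_coe, Homeomorph.coe_mulRight₀] at h2
  rw [h2]
  rfl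

theorem ae_comp_div {a : ℝ} (ha : a ≠ 0) {P : ℝ → Prop} (h : ∀ᵐ x, P x) : ∀ᵐ x, P (x / a) := by
  have h1 := Real.map_volume_mul_right (inv_ne_zero ha)
  have h2 : ∀ᵐ x ∂(Measure.map (fun x : ℝ => x * a⁻¹) volume), P x := by
    rw [h1]
    exact Measure.ae_smul_measure h _
  exact ae_of_ae_map (by fun_prop) h2

theorem kernelIntegral_mul (lam : ℝ) (x t : ℝ) {a : ℝ} :
    kernelIntegral lam (a * x) (a * t) = (a ^ 2) ^ (-(lam + 1)) * kernelIntegral lam x t := by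
  unfold kernelIntegral
  rw [← intervalIntegral.integral_const_mul]
  refine intervalIntegral.integral_congr fun s hs => ?_
  rw [Set.uIcc_of_le (by norm_num)] at hs
  have hq : 0 ≤ quad x t s := (sq_nonneg _).trans (sq_le_quad x t hs.1 hs.2)
  have e : quad (a * x) (a * t) s = a ^ 2 * quad x t s := by
    unfold quad
    ring
  rw [e, Real.mul_rpow (sq_nonneg a) hq, Real.rpow_neg (sq_nonneg a)]
  field_simp

/-- The `λ`-Hilbert transform commutes with dilations up to the sign of the factor. -/
theorem truncatedHilbert_dilate (lam : ℝ) {a : ℝ} (ha : a ≠ 0) (f : ℝ → ℂ) (x ε : ℝ) :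
    truncatedHilbert lam f x ε =
      ((a / |a| : ℝ) : ℂ) * truncatedHilbert lam (fun t => f (a * t)) (x / a) (ε / |a|) := by
  have ha' : 0 < |a| := abs_pos.2 ha
  unfold truncatedHilbert
  rw [mul_left_comm]
  congr 1
  rw [← integral_indicator (measurableSet_trunc _ _), ← integral_indicator (measurableSet_trunc _ _),
    ← integral_const_mul]
  have h := Measure.integral_comp_mul_left ({t : ℝ | ε < |t - x|}.indicator fun t =>
    f t * (hilbertKernel lam x t : ℂ) * ((|t| ^ (2 * lam) : ℝ) : ℂ)) a
  rw [abs_inv, ← inv_smul_eq_iff₀ (by positivity), inv_inv] at h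
  rw [← h, ← integral_smul]
  congr 1
  ext t
  have hiff : a * t ∈ {t : ℝ | ε < |t - x|} ↔ t ∈ {t : ℝ | ε / |a| < |t - x / a|} := by
    simp only [Set.mem_ofPred_eq]
    rw [div_lt_iff₀ ha', ← abs_mul]
    have : (t - x / a) * a = a * t - x := by field_simp
    rw [this]
  by_cases ht : t ∈ {t : ℝ | ε / |a| < |t - x / a|}
  · rw [Set.indicator_of_mem ht, Set.indicator_of_mem (hiff.2 ht)]
    have hx : x = a * (x / a) := by field_simp
    -- Degrees cancel: -2(λ + 1) from the kernel integral, 1 from x - t, 2λ from the weight and 1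
    -- from dt. Only x - t sees the sign of a.
    have hk : |a| * (hilbertKernel lam x (a * t) * |a * t| ^ (2 * lam)) =
        a / |a| * (hilbertKernel lam (x / a) t * |t| ^ (2 * lam)) := by
      nth_rewrite 1 [hx]
      rw [hilbertKernel_eq, hilbertKernel_eq, kernelIntegral_mul, abs_mul,
        Real.mul_rpow (abs_nonneg _) (abs_nonneg _)]
      have e : (a ^ 2) ^ (-(lam + 1)) * |a| ^ (2 * lam) = (|a| ^ 2)⁻¹ := by
        rw [← sq_abs, ← Real.rpow_natCast, ← Real.rpow_mul ha'.le, ← Real.rpow_add ha',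
          ← Real.rpow_neg ha'.le]
        congr 1
        push_cast
        ring
      calc _ = |a| * a * (kernelConst lam * (x / a - t) * kernelIntegral lam (x / a) t *
            |t| ^ (2 * lam)) * ((a ^ 2) ^ (-(lam + 1)) * |a| ^ (2 * lam)) := by ring
        _ = _ := by
          rw [e]
          field_simp
    rw [Complex.real_smul]
    calc _ = f (a * t) * ((|a| * (hilbertKernel lam x (a * t) * |a * t| ^ (2 * lam)) : ℝ) : ℂ) := by
          push_cast
          ring
      _ = _ := by
          rw [hk]
          push_cast
          ring
  · rw [Set.indicator_of_notMem ht, Set.indicator_of_notMem (fun h' => ht (hiff.1 h')), smul_zero,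
      mul_zero]

theorem truncatedHilbert_congr_ae {lam : ℝ} {f g : ℝ → ℂ} (h : f =ᵐ[volume] g) (x ε : ℝ) :
    truncatedHilbert lam f x ε = truncatedHilbert lam g x ε := by
  unfold truncatedHilbert
  congr 1
  refine integral_congr_ae (ae_restrict_of_ae ?_)
  filter_upwards [h] with t ht
  rw [ht]

theorem truncatedHilbert_const_mul (lam : ℝ) (f : ℝ → ℂ) (M : ℂ) (x ε : ℝ) :
    truncatedHilbert lam (fun t => M * f t) x ε = M * truncatedHilbert lam f x ε := by
  unfold truncatedHilbert
  rw [mul_left_comm]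
  congr 1
  rw [← integral_const_mul]
  simp only [mul_assoc]

/-- On the interval |x| ≥ |x₀| - δ₀ > |x₀|/2. -/
theorem le_weightedLength {lam x₀ δ₀ : ℝ} (hl : 0 < lam) (hδ0 : 0 < δ₀) (hδ : δ₀ < |x₀| / 2) :
    2 * δ₀ * (|x₀| / 2) ^ (2 * lam) ≤ weightedLength lam x₀ δ₀ := by
  have hcont : Continuous fun x : ℝ => |x| ^ (2 * lam) :=
    continuous_abs.rpow_const fun x => Or.inr (by linarith)
  calc 2 * δ₀ * (|x₀| / 2) ^ (2 * lam)
      = ∫ x in Set.Ioo (x₀ - δ₀) (x₀ + δ₀), (|x₀| / 2) ^ (2 * lam) := by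
        rw [setIntegral_const, Real.volume_real_Ioo_of_le (by linarith), smul_eq_mul]
        ring
    _ ≤ _ := by
        refine setIntegral_mono_on (by simp)
          (hcont.integrableOn_Icc.mono_set Set.Ioo_subset_Icc_self) measurableSet_Ioo fun x hx => ?_
        refine Real.rpow_le_rpow (by positivity) ?_ (by linarith)
        have h1 : |x₀ - x| ≤ δ₀ := by rw [abs_le]; constructor <;> linarith [hx.1, hx.2]
        have h2 := abs_sub_abs_le_abs_sub x₀ x
        linarith

/-- An atom is, up to a dilation, a multiple of a bounded function adapted to an interval around
`1`. -/
theorem IsAtom.exists_normalized {lam p A : ℝ} {κ : ℕ} {a : ℝ → ℂ} (hl : 0 < lam) (hA : 0 < A)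
    (ha : IsAtom lam p A κ a) : ∃ (b : ℝ → ℂ) (x₀ δ₀ : ℝ), 0 < δ₀ ∧ δ₀ < |x₀| / 2 ∧
      Measurable b ∧ (∀ t, ‖b t‖ ≤ 1) ∧
      (∀ t, t ∉ Set.Ioo (1 - δ₀ / |x₀|) (1 + δ₀ / |x₀|) → b t = 0) ∧
      (∀ j ≤ κ, ∫ t : ℝ, (t : ℂ) ^ j * b t * ((|t| ^ (2 * lam) : ℝ) : ℂ) = 0) ∧
      ∀ᵐ t : ℝ, a t = ((A / weightedLength lam x₀ δ₀ ^ (1 / p) : ℝ) : ℂ) * b (t / x₀) := by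
  obtain ⟨x₀, δ₀, hδ0, hδ, hsize, hsupp⟩ := ha.size_support
  have hx0 : 0 < |x₀| := by linarith
  have hx : x₀ ≠ 0 := abs_pos.1 hx0
  have hwl : 0 < weightedLength lam x₀ δ₀ :=
    lt_of_lt_of_le (by positivity) (le_weightedLength hl hδ0 hδ)
  set M := A / weightedLength lam x₀ δ₀ ^ (1 / p) with hM
  have hM0 : 0 < M := by positivity
  set a' := ha.measurable.mk a with ha'
  have ham : Measurable a' := ha.measurable.measurable_mk
  -- Restricting a measurable representative to S changes a on a null set only, and makes the size
  -- and support conditions hold at every point.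
  set S : Set ℝ := {t | ‖a' t‖ ≤ M} ∩ Set.Ioo (x₀ - δ₀) (x₀ + δ₀) with hS
  have hSm : MeasurableSet S := (measurableSet_le ham.norm measurable_const).inter measurableSet_Ioo
  set u := S.indicator a' with hu
  have hum : Measurable u := ham.indicator hSm
  have hae : a =ᵐ[volume] u := by
    filter_upwards [ha.measurable.ae_eq_mk, hsupp, ae_le_eLpNormEssSup (f := a) (μ := volume)]
      with t h1 h2 h3
    rw [eLpNorm_exponent_top] at hsize
    have h4 : ‖a t‖ ≤ M := by
      have := h3.trans hsize
      rwa [← ofReal_norm, ENNReal.ofReal_le_ofReal_iff hM0.le] at this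
    by_cases h5 : t ∈ S
    · rw [hu, Set.indicator_of_mem h5, h1]
    · rw [hu, Set.indicator_of_notMem h5]
      by_cases h6 : t ∈ Set.Ioo (x₀ - δ₀) (x₀ + δ₀)
      · exact absurd ⟨by rw [Set.mem_ofPred_eq, ha', ← h1]; exact h4, h6⟩ h5
      · exact h2 h6
  have hub : ∀ t, ‖u t‖ ≤ M := fun t => by
    by_cases h5 : t ∈ S
    · rw [hu, Set.indicator_of_mem h5]
      exact h5.1
    · rw [hu, Set.indicator_of_notMem h5, norm_zero]
      exact hM0.le
  refine ⟨fun t => (M : ℂ)⁻¹ * u (x₀ * t), x₀, δ₀, hδ0, hδ, by fun_prop, fun t => ?_,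
    fun t ht => ?_, fun j hj => ?_, ?_⟩
  · rw [norm_mul, norm_inv, Complex.norm_real, Real.norm_of_nonneg hM0.le, inv_mul_le_iff₀ hM0,
      mul_one]
    exact hub _
  · simp only
    rw [hu, Set.indicator_of_notMem, mul_zero]
    intro h
    refine ht ?_
    have h1 : |x₀ * t - x₀| < δ₀ := by
      rw [abs_lt]
      constructor <;> linarith [h.2.1, h.2.2]
    rw [show x₀ * t - x₀ = x₀ * (t - 1) by ring, abs_mul, mul_comm, ← lt_div_iff₀ hx0, abs_lt] at h1
    constructor <;> linarith [h1.1, h1.2]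
  · have h1 := ha.moments j hj
    have h2 : ∫ t : ℝ, (t : ℂ) ^ j * u t * ((|t| ^ (2 * lam) : ℝ) : ℂ) = 0 := by
      rw [← h1]
      refine integral_congr_ae ?_
      filter_upwards [hae] with t ht
      rw [ht]
    have h3 := Measure.integral_comp_mul_left
      (fun t : ℝ => (t : ℂ) ^ j * u t * ((|t| ^ (2 * lam) : ℝ) : ℂ)) x₀
    rw [h2, smul_zero] at h3
    have e : ∀ t : ℝ, (t : ℂ) ^ j * ((M : ℂ)⁻¹ * u (x₀ * t)) * ((|t| ^ (2 * lam) : ℝ) : ℂ) =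
        ((M : ℂ)⁻¹ * ((x₀ : ℂ) ^ j)⁻¹ * ((|x₀| ^ (2 * lam) : ℝ) : ℂ)⁻¹) *
          (((x₀ * t : ℝ) : ℂ) ^ j * u (x₀ * t) * ((|x₀ * t| ^ (2 * lam) : ℝ) : ℂ)) := fun t => by
      rw [abs_mul, Real.mul_rpow (abs_nonneg _) (abs_nonneg _)]
      have e1 : ((|x₀| ^ (2 * lam) : ℝ) : ℂ) ≠ 0 :=
        Complex.ofReal_ne_zero.2 (Real.rpow_pos_of_pos hx0 _).ne'
      have e2 : (x₀ : ℂ) ≠ 0 := Complex.ofReal_ne_zero.2 hx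
      have e3 : (M : ℂ) ≠ 0 := Complex.ofReal_ne_zero.2 hM0.ne'
      rw [Complex.ofReal_mul, Complex.ofReal_mul, mul_pow]
      field_simp
    simp only [e]
    rw [integral_const_mul, h3, mul_zero]
  · filter_upwards [hae] with t ht
    have e3 : (M : ℂ) ≠ 0 := Complex.ofReal_ne_zero.2 hM0.ne'
    rw [ht, mul_div_cancel₀ _ hx, mul_inv_cancel_left₀ e3]

end Dunkl

/-! ### Transfer to general atoms -/

theorem theoremp (lam p : ℝ) (hlam : 0 < lam)
    (hp : 2 * lam / (2 * lam + 1) < p) (hp1 : p ≤ 1) :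
    ∃ C : ℝ, 0 < C ∧
      ∀ (A : ℝ) (κ : ℕ) (a : ℝ → ℂ), 0 < A → Dunkl.IsAtom lam p A κ a →
        (∀ᵐ x : ℝ, Tendsto (Dunkl.truncatedHilbert lam a x) (𝓝[>] (0 : ℝ))
          (𝓝 (Dunkl.hilbertTransform lam a x))) ∧
        ∫⁻ x : ℝ, ENNReal.ofReal (‖Dunkl.hilbertTransform lam a x‖ ^ p * |x| ^ (2 * lam))
          ≤ ENNReal.ofReal (C * A ^ p) := by
  have hp0 : 0 < p := lt_trans (by positivity) hp
  set y : ℝ := (2 * lam + 1) * ((1 - p) / p) with hy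
  have hy0 : 0 ≤ y := mul_nonneg (by linarith) (div_nonneg (by linarith) hp0.le)
  -- With k = [y] + 1 > y one gets k p > (2λ + 1)(1 - p), which is the far-region condition after
  -- adding p. Orders j < k satisfy j ≤ [y] ≤ 2[y] ≤ κ.
  set k : ℕ := ⌊y⌋.toNat + 1 with hk
  have hfl : ((⌊y⌋.toNat : ℤ)) = ⌊y⌋ := Int.toNat_of_nonneg (Int.floor_nonneg.2 hy0)
  have hky : y < (k : ℝ) := by
    have h1 := Int.lt_floor_add_one y
    have h2 : ((⌊y⌋.toNat : ℝ)) = (⌊y⌋ : ℝ) := by exact_mod_cast hfl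
    rw [hk]
    push_cast
    rw [h2]
    exact h1
  have hkp : 1 + 2 * lam * (1 - p) < ((k : ℝ) + 1) * p := by
    have h1 : y * p = (2 * lam + 1) * (1 - p) := by
      rw [hy]
      field_simp
    have h2 := mul_lt_mul_of_pos_right hky hp0
    nlinarith
  obtain ⟨C, hC, hcore⟩ := Dunkl.exists_core_bound hlam hp0 hp1 hkp
  refine ⟨C * 2 ^ (2 * lam), by positivity, fun A κ a hA ha => ?_⟩
  obtain ⟨b, x₀, δ₀, hδ0, hδ, hbm, hb, hbs, hmom, hab⟩ := ha.exists_normalized hlam hA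
  have hx0 : 0 < |x₀| := by linarith
  have hx : x₀ ≠ 0 := abs_pos.1 hx0
  have hwl := Dunkl.le_weightedLength (lam := lam) hlam hδ0 hδ
  have hlow : 0 < 2 * δ₀ * (|x₀| / 2) ^ (2 * lam) := by positivity
  set W := Dunkl.weightedLength lam x₀ δ₀ with hW
  have hW0 : 0 < W := hlow.trans_le hwl
  set M := A / W ^ (1 / p) with hM
  have hM0 : 0 < M := by positivity
  have hmom' : ∀ j < k, ∫ t : ℝ, (t : ℂ) ^ j * b t * ((|t| ^ (2 * lam) : ℝ) : ℂ) = 0 := by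
    intro j hj
    refine hmom j ?_
    have h1 := ha.order
    rw [← hy] at h1
    omega
  obtain ⟨hlim, hint⟩ := hcore b (δ₀ / |x₀|) (by positivity)
    (by rw [div_lt_iff₀ hx0]; linarith) hbm hb hbs hmom'
  have htrunc : ∀ x ε : ℝ, Dunkl.truncatedHilbert lam a x ε =
      ((x₀ / |x₀| : ℝ) : ℂ) * (M : ℂ) * Dunkl.truncatedHilbert lam b (x / x₀) (ε / |x₀|) :=
    fun x ε => by
      rw [Dunkl.truncatedHilbert_congr_ae hab, Dunkl.truncatedHilbert_dilate lam hx]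
      simp only [mul_div_cancel_left₀ _ hx]
      rw [Dunkl.truncatedHilbert_const_mul, mul_assoc]
  have hscale : Tendsto (fun ε : ℝ => ε / |x₀|) (𝓝[>] 0) (𝓝[>] 0) := by
    refine tendsto_nhdsWithin_iff.2 ⟨?_, ?_⟩
    · have : Tendsto (fun ε : ℝ => ε / |x₀|) (𝓝 0) (𝓝 (0 / |x₀|)) := tendsto_id.div_const _
      rw [zero_div] at this
      exact this.mono_left nhdsWithin_le_nhds
    · filter_upwards [self_mem_nhdsWithin] with ε hε using div_pos hε hx0
  have hlima : ∀ᵐ x : ℝ, Tendsto (Dunkl.truncatedHilbert lam a x) (𝓝[>] (0 : ℝ))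
      (𝓝 (((x₀ / |x₀| : ℝ) : ℂ) * (M : ℂ) * Dunkl.hilbertTransform lam b (x / x₀))) := by
    filter_upwards [Dunkl.ae_comp_div hx hlim] with x h
    refine ((h.comp hscale).const_mul (((x₀ / |x₀| : ℝ) : ℂ) * (M : ℂ))).congr fun ε => ?_
    rw [htrunc]
    rfl
  refine ⟨hlima.mono fun x h => tendsto_nhds_limUnder ⟨_, h⟩, ?_⟩
  have hMp : M ^ p = A ^ p / W := by
    rw [hM, Real.div_rpow hA.le (by positivity), ← Real.rpow_mul hW0.le, one_div_mul_cancel hp0.ne',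
      Real.rpow_one]
  calc ∫⁻ x : ℝ, ENNReal.ofReal (‖Dunkl.hilbertTransform lam a x‖ ^ p * |x| ^ (2 * lam))
      = ∫⁻ x : ℝ, ENNReal.ofReal (M ^ p * |x₀| ^ (2 * lam)) *
          ENNReal.ofReal (‖Dunkl.hilbertTransform lam b (x / x₀)‖ ^ p * |x / x₀| ^ (2 * lam)) := by
        refine lintegral_congr_ae ?_
        filter_upwards [hlima] with x h
        rw [← ENNReal.ofReal_mul (by positivity)]
        congr 1
        have e : Dunkl.hilbertTransform lam a x =
            ((x₀ / |x₀| : ℝ) : ℂ) * (M : ℂ) * Dunkl.hilbertTransform lam b (x / x₀) := h.limUnder_eq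
        rw [e, norm_mul, norm_mul, Complex.norm_real, Complex.norm_real, norm_div, Real.norm_eq_abs |x₀|, abs_abs,
          Real.norm_eq_abs, div_self hx0.ne', one_mul, Real.norm_of_nonneg hM0.le,
          Real.mul_rpow hM0.le (norm_nonneg _), abs_div, Real.div_rpow (abs_nonneg _) (abs_nonneg _)]
        have := (Real.rpow_pos_of_pos hx0 (2 * lam)).ne'
        field_simp
    _ = ENNReal.ofReal (M ^ p * |x₀| ^ (2 * lam)) * (ENNReal.ofReal |x₀| *
          ∫⁻ x : ℝ, ENNReal.ofReal (‖Dunkl.hilbertTransform lam b x‖ ^ p * |x| ^ (2 * lam))) := by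
        rw [lintegral_const_mul' _ _ ENNReal.ofReal_ne_top, Dunkl.lintegral_comp_div hx fun x =>
          ENNReal.ofReal (‖Dunkl.hilbertTransform lam b x‖ ^ p * |x| ^ (2 * lam))]
    _ ≤ ENNReal.ofReal (M ^ p * |x₀| ^ (2 * lam)) * (ENNReal.ofReal |x₀| *
          ENNReal.ofReal (C * (δ₀ / |x₀|))) := by gcongr
    _ ≤ ENNReal.ofReal (C * 2 ^ (2 * lam) * A ^ p) := by
        rw [← ENNReal.ofReal_mul hx0.le, ← ENNReal.ofReal_mul (by positivity)]
        refine ENNReal.ofReal_le_ofReal ?_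
        -- The product to bound is C A^p δ₀ |x₀|^(2λ) / W, and the lower bound for W absorbs δ₀
        -- |x₀|^(2λ) at the cost of 2^(2λ).
        rw [hMp]
        rw [Real.div_rpow hx0.le (by norm_num), mul_div_assoc', div_le_iff₀ (by positivity)] at hwl
        have e : A ^ p / W * |x₀| ^ (2 * lam) * (|x₀| * (C * (δ₀ / |x₀|))) =
            C * A ^ p * (δ₀ * |x₀| ^ (2 * lam)) / W := by
          field_simp
        rw [e, div_le_iff₀ hW0]
        have hA' : 0 ≤ C * A ^ p := by positivity
        have h1 : δ₀ * |x₀| ^ (2 * lam) ≤ W * 2 ^ (2 * lam) := by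
          have : 0 ≤ δ₀ * |x₀| ^ (2 * lam) := by positivity
          linarith
        calc _ ≤ C * A ^ p * (W * 2 ^ (2 * lam)) := mul_le_mul_of_nonneg_left h1 hA'
          _ = _ := by ring
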